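/- **Setting (partial cost model).** A list holds $n$ items. Let $\Sigma$ be the set of finite request sequences (sequences of items) and $\mathcal L$ the set of the $n!$ list states. Exchanging two items in consecutive positions of the list (a paid exchange) costs $1$; accessing the item in the $i$th position costs $i-1$. To serve a request to $x$, the list is first rearranged from its current state to a new one, at a cost equal to the least number of paid exchanges needed, and then $x$ is accessed in the new state. $\mathrm{OPT}(L_0,\sigma)$ is the least total cost of serving $\sigma$ from the initial list state $L_0$ with an arbitrary sequence of list states. A deterministic online algorithm is a map $S:\Sigma\to\mathcal L$, where $S(\sigma)$ is the list state after $\sigma$ has been served and $S(\emptyset)$ is the initial list state; $S$ is projective if for all items $x,y$ and all $\sigma\in\Sigma$ the relative order of $x$ and $y$ in $S(\sigma)$ is the same as in $S(\sigma_{xy})$, where $\sigma_{xy}$ results from $\sigma$ by deleting the requests to all other items. A randomized online algorithm $A$ with initial list state $L_0$ is a probability distribution on the deterministic online algorithms with $S(\emptyset)=L_0$ (with the product $\sigma$-algebra on $\mathcal L^\Sigma$); it is projective if the chosen deterministic algorithm is projective with probability $1$. Its expected cost of serving $\sigma$ is $E[A(\sigma)]$. **COMB.** For a function $F$ assigning to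 each item $x$ and each $i\ge0$ an integer $F(x^i)\in\{0,\dots,i\}$, the critical request algorithm given by $F$ has the following list state after $\sigma$. If $x$ is requested $i$ times in $\sigma$ and $F(x^i)>0$, the $F(x^i)$th request to $x$ is its critical request. The items with a critical request come first, those with later critical requests closer to the front; the items without a critical request follow, in their initial order. TS is given by $F(x^0)=0$ and $F(x^i)=i-1$ for $i>0$. BIT is given by $F(x^0)=0$ and $F(x^i)=i-((b_x+i)\bmod 2)$ for $i>0$, with independent, uniformly distributed bits $b_x\in\{0,1\}$, one per item, chosen once at the start. COMB serves the whole request sequence with BIT with probability $4/5$ and with TS with probability $1/5$. **Theorem.** Let $n\ge 3$. 1. Let $A$ be a randomized projective online algorithm for a list of $n$ items with any initial list state $L_0$. If $c,b\in\mathbb R$ are such that $E[A(\sigma)]\le c\cdot \mathrm{OPT}(L_0,\sigma)+b$ for all request sequences $\sigma$, then $c\ge 1.6$. In particular, no randomized projective algorithm is $c$-competitive for any $c<1.6$. 2. COMB is a best possible projective algorithm: it is projective for every initial list state, and it is $1.6$-competitive, that is, there is a constant $b$ such that $E[\mathrm{COMB}(\sigma)]\le 1.6\cdot \mathrm{OPT}(L_0,\sigma)+b$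 for all request sequences $\sigma$ and all initial list states $L_0$. -/

import Mathlib

open MeasureTheory
open scoped ENNReal

namespace ListUpdate

noncomputable section

/-- A state of the list of the items `0, …, n - 1`: the bijection which sends every item to its
position. Positions are counted from `0` at the front, so item `x` is in front of item `y` in
state `s` iff `s x < s y`. -/
abbrev ListState (n : ℕ) : Type := Fin n ≃ Fin n

/-- The finite set of list states is a discrete measurable space. -/
instance instMeasurableSpaceListState (n : ℕ) : MeasurableSpace (ListState n) := ⊤

/-- Two list states are adjacent iff one results from the other by one paid exchange, that is, by
exchanging the two items in some consecutive positions `i` and `i + 1`. -/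
def exchangeGraph (n : ℕ) : SimpleGraph (ListState n) :=
  SimpleGraph.fromRel fun s t =>
    ∃ i j : Fin n, (j : ℕ) = (i : ℕ) + 1 ∧ t = s.trans (Equiv.swap i j)

/-- The cost of rearranging the list from state `s` to state `t` by paid exchanges of unit cost:
the least number of paid exchanges which lead from `s` to `t`. (The graph is connected.) -/
def rearrangeCost {n : ℕ} (s t : ListState n) : ℕ :=
  (exchangeGraph n).dist s t

/-- The partial access cost: an item in the `i`-th position, counted from `1`, costs `i - 1`. -/
def accessCost {n : ℕ} (s : ListState n) (x : Fin n) : ℕ :=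
  (s x : ℕ)

/-- The cost of serving the request sequence `σ` with the list states `T 0` (initially),
`T 1`, `T 2`, …, where `T k` is the state after the first `k` requests: for each request, the list
is first rearranged by paid exchanges, and then the requested item is accessed. -/
def serveCost {n : ℕ} (T : ℕ → ListState n) (σ : List (Fin n)) : ℕ :=
  ∑ k : Fin σ.length, (rearrangeCost (T k) (T (k + 1)) + accessCost (T (k + 1)) (σ.get k))

/-- The optimum offline cost of serving `σ` from the initial list state `L₀`. -/
def OPT {n : ℕ} (L₀ : ListState n) (σ : List (Fin n)) : ℕ :=
  sInf {k | ∃ T : ℕ → ListState n, T 0 = L₀ ∧ serveCost T σ = k}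

/-- A deterministic online algorithm, given by the list state `S σ` after having served the
request sequence `σ` (in chronological order). Its initial list state is `S []`.
The set of these algorithms carries the product σ-algebra. -/
abbrev OnlineAlgorithm (n : ℕ) : Type := List (Fin n) → ListState n

/-- The cost of the deterministic online algorithm `S` on the request sequence `σ`. -/
def OnlineAlgorithm.cost {n : ℕ} (S : OnlineAlgorithm n) (σ : List (Fin n)) : ℕ :=
  serveCost (fun k => S (σ.take k)) σ

/-- The projection `σ_{xy}`: delete all requests to items other than `x` and `y`. -/
def proj {n : ℕ} (x y : Fin n) (σ : List (Fin n)) : List (Fin n) :=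
  σ.filter fun z => z = x ∨ z = y

/-- A deterministic algorithm is projective if the relative order of any two items `x`, `y` after
any `σ` is the same as after `σ_{xy}`. -/
def OnlineAlgorithm.IsProjective {n : ℕ} (S : OnlineAlgorithm n) : Prop :=
  ∀ (x y : Fin n) (σ : List (Fin n)), S σ x < S σ y ↔ S (proj x y σ) x < S (proj x y σ) y

/-- A randomized online algorithm with initial list state `L₀`: an arbitrary probability
distribution on the deterministic online algorithms with initial list state `L₀`. -/
structure RandomizedAlgorithm {n : ℕ} (L₀ : ListState n) where
  law : Measure (OnlineAlgorithm n)
  isProbabilityMeasure : IsProbabilityMeasure law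
  init : ∀ᵐ S ∂law, S [] = L₀

namespace RandomizedAlgorithm

variable {n : ℕ} {L₀ : ListState n}

/-- The expected cost of `A` on `σ`. (The cost is a bounded measurable function of the chosen
deterministic algorithm.) -/
def expectedCost (A : RandomizedAlgorithm L₀) (σ : List (Fin n)) : ℝ :=
  ∫ S, (OnlineAlgorithm.cost S σ : ℝ) ∂A.law

/-- The deterministic algorithm chosen by `A` is projective with probability one. For a discrete
distribution this says that each algorithm chosen with positive probability is projective. -/
def IsProjective (A : RandomizedAlgorithm L₀) : Prop :=
  ∀ᵐ S ∂A.law, OnlineAlgorithm.IsProjective S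

/-- The inequality in the definition of a `c`-competitive algorithm, with additive constant `b`,
for the given initial list state and all request sequences. -/
def IsCompetitiveWith (A : RandomizedAlgorithm L₀) (c b : ℝ) : Prop :=
  ∀ σ : List (Fin n), A.expectedCost σ ≤ c * (OPT L₀ σ : ℝ) + b

end RandomizedAlgorithm

/-- The time (counted from `1`) of the `q`-th request to `x` in `σ`, i.e. the length of the
shortest prefix of `σ` with `q` requests to `x`, if `1 ≤ q ≤ σ.count x`; it is `0` for `q = 0`. -/
def requestTime {n : ℕ} (σ : List (Fin n)) (x : Fin n) (q : ℕ) : ℕ :=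
  sInf {k | (σ.take k).count x = q}

/-- The critical request algorithm with critical request function `F` (where `F x i ≤ i`): after
`σ` with `i` requests to `x`, the critical request to `x` is the `F x i`-th one (none if
`F x i = 0`). The items with a critical request come first, the later that request the closer to
the front; the items without one follow in their initial order.
So the items are sorted by decreasing time of the critical request (`0` if there is none), and then
by their initial position. -/
def criticalRequestAlgorithm {n : ℕ} (F : Fin n → ℕ → ℕ) (L₀ : ListState n) : OnlineAlgorithm n :=
  fun σ => (Tuple.sort fun x : Fin n =>
    toLex (OrderDual.toDual (requestTime σ x (F x (σ.count x))), L₀ x)).symm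

/-- The critical request function `i ↦ i - ((b x + i) mod 2)` (and `0 ↦ 0`) of BIT, for the
initial bits `b x`. -/
def bitF {n : ℕ} (b : Fin n → Fin 2) (x : Fin n) (i : ℕ) : ℕ := i - ((b x : ℕ) + i) % 2

/-- The critical request function `i ↦ i - 1` (and `0 ↦ 0`) of TS: the critical request is the
last but one. -/
def tsF {n : ℕ} (_x : Fin n) (i : ℕ) : ℕ := i - 1

/-- The distribution of BIT: the bits `b x` are independent and uniform. -/
def bitLaw {n : ℕ} (L₀ : ListState n) : Measure (OnlineAlgorithm n) :=
  ∑ b : Fin n → Fin 2, ((2 : ℝ≥0∞) ^ n)⁻¹ • Measure.dirac (criticalRequestAlgorithm (bitF b) L₀)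

/-- The distribution of COMB: BIT with probability `4/5` and TS with probability `1/5`. -/
def combLaw {n : ℕ} (L₀ : ListState n) : Measure (OnlineAlgorithm n) :=
  (4 / 5 : ℝ≥0∞) • bitLaw L₀ + (1 / 5 : ℝ≥0∞) • Measure.dirac (criticalRequestAlgorithm tsF L₀)

theorem criticalRequestAlgorithm_nil {n : ℕ} (F : Fin n → ℕ → ℕ) (hF : ∀ x, F x 0 = 0)
    (L₀ : ListState n) : criticalRequestAlgorithm F L₀ [] = L₀ := by
  have hs : ∀ x : Fin n, requestTime [] x (F x (([] : List (Fin n)).count x)) = 0 := by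
    intro x
    simp [requestTime, hF]
  unfold criticalRequestAlgorithm
  simp only [hs]
  have : Tuple.sort (fun x : Fin n => toLex (OrderDual.toDual (0 : ℕ), L₀ x)) = L₀.symm := by
    symm
    rw [Tuple.eq_sort_iff]
    refine ⟨?_, ?_⟩
    · intro i j hij
      simp only [Function.comp, Equiv.apply_symm_apply]
      rw [Prod.Lex.toLex_le_toLex]
      exact Or.inr ⟨rfl, hij⟩
    · intro i j hij h
      simp only [Equiv.apply_symm_apply] at h
      have := (Prod.ext_iff.1 (toLex.injective h)).2
      exact absurd this hij.ne
  rw [this]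
  rfl

theorem bitLaw_univ {n : ℕ} (L₀ : ListState n) : bitLaw L₀ Set.univ = 1 := by
  have h0 : ((2 : ℝ≥0∞) ^ n) ≠ 0 := by simp
  have ht : ((2 : ℝ≥0∞) ^ n) ≠ ∞ := by simp
  simp [bitLaw, ENNReal.mul_inv_cancel h0 ht]

theorem combLaw_univ {n : ℕ} (L₀ : ListState n) : combLaw L₀ Set.univ = 1 := by
  simp only [combLaw, Measure.add_apply, Measure.smul_apply, bitLaw_univ, smul_eq_mul, mul_one,
    measure_univ]
  rw [← ENNReal.add_div]
  norm_num
  exact ENNReal.div_self (by norm_num) (by norm_num)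

theorem combLaw_init {n : ℕ} (L₀ : ListState n) : ∀ᵐ S ∂combLaw L₀, S [] = L₀ := by
  have hm : MeasurableSet {S : OnlineAlgorithm n | S [] = L₀} :=
    (measurable_pi_apply (X := fun _ : List (Fin n) => ListState n) [])
      (MeasurableSpace.measurableSet_top (s := {L₀}))
  have hb : ∀ b : Fin n → Fin 2, criticalRequestAlgorithm (bitF b) L₀ [] = L₀ := fun b =>
    criticalRequestAlgorithm_nil _ (fun x => by simp [bitF]) L₀
  have ht : criticalRequestAlgorithm tsF L₀ [] = L₀ :=
    criticalRequestAlgorithm_nil _ (fun x => by simp [tsF]) L₀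
  have hc : MeasurableSet {S : OnlineAlgorithm n | ¬ S [] = L₀} := hm.compl
  rw [ae_iff]
  simp [combLaw, bitLaw, Measure.dirac_apply' _ hc, hb, ht]

/-- The randomized algorithm COMB with initial list state `L₀`. -/
def COMB {n : ℕ} (L₀ : ListState n) : RandomizedAlgorithm L₀ where
  law := combLaw L₀
  isProbabilityMeasure := ⟨combLaw_univ L₀⟩
  init := combLaw_init L₀

end

end ListUpdate

/-!
Why no projective algorithm is better than `8 / 5`, and why COMB attains this ratio.

**Lower bound.** Let `S` be a deterministic projective algorithm and `x`, `y`, `z` three items. Consider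
all rearrangements of a sequence with `i`, `j`, `k` requests to them. If exchanging two neighbouring
requests to `x` and `y` changes the order of `x` and `y` in the list, and exchanging two neighbouring
requests to `x` and `z` changes the order of `x` and `z`, then the same request to `x` is involved
(`critical_request_unique`): otherwise both exchanges can be made independently in one common sequence,
without affecting the order of `y` and `z`, and one of the four resulting orders is cyclic. Hence,
unless `z` has a constant order with `x` or with `y`, the order of `x` and `y` depends only on which of
two critical requests comes later (`exists_critical_requests`); let `fx` and `fy` be the numbers of
requests to `x` and `y` after these. Fix `i`, `j`, `k`, and look at the states after histories with
just these numbers of requests, for each prefix of `T` cycles `x^P y x^P y^P x y^P` (with `P = 8 T`), followed by `T`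
alternations `x y`. If `S` moves items with later critical requests to the front, these requests cost
at least `T` times
`(fx + 1) + 1 + [fy = 0] (fx + 1) + (fy + 1) + 1 + [fx = 0] (fy + 1)` for the cycles and `T` times
`[fy ≤ fx] + [fx ≤ fy]` for the alternations, up to a constant, which is at least `8 T`
(`eight_mul_le`), whereas the offline cost is about `5 T`. All other kinds of behaviour (constant
orders, critical requests which lie far back, critical requests which move items to the back) are so
expensive on a few initial long runs that the same bound holds (`le_sumAlong_hardTail`). The cost of an
actual sequence involves varying values of `i`, `j`, `k`; but summed over all numbers of initial
requests to the three items, it contains, up to boundary terms, the sum of the costs at the single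
points `(i, j, k)` (`sum_sumAlong_paddedHistory_le`). So the sum of the costs over these sequences is
large for every projective `S`, and thus in expectation for a randomized projective algorithm.

**Upper bound.** For TS and for BIT, the critical request is the last or the last but one. Therefore
the cost is the sum, over all requests and all other items, of the events that the other item is in
front of the requested one just before the request (`cost_criticalRequestAlgorithm_le`), and the
probability of this event under COMB is determined by the order of the last two requests to the one
item and the last two to the other. These orders have six relevant states (`PairState`), with a
potential for which the amortized cost of COMB is at most `8 / 5` times the offline cost of the pair
(`PairState.cost_add_potential_le`). The offline cost is at least the sum of its contributions from the
pairs, since the cost of rearranging the list is the number of inversions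
(`rearrangeCost_eq_card_inversions`).
-/

namespace ListUpdate

/-! ### The rearrangement cost is the number of inversions -/

/-- The inversions between two list states: the ordered pairs `(u, v)` with `u` in front of `v` in
the first state and behind `v` in the second. -/
def inversions {n : ℕ} (s t : ListState n) : Finset (Fin n × Fin n) :=
  Finset.univ.filter fun p => s p.1 < s p.2 ∧ t p.2 < t p.1

theorem mem_inversions {n : ℕ} {s t : ListState n} {u v : Fin n} :
    (u, v) ∈ inversions s t ↔ s u < s v ∧ t v < t u := by
  simp [inversions]

theorem exchangeGraph_adj {n : ℕ} {s t : ListState n} (h : (exchangeGraph n).Adj s t) :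
    ∃ i j : Fin n, (j : ℕ) = (i : ℕ) + 1 ∧ t = s.trans (Equiv.swap i j) := by
  rw [exchangeGraph, SimpleGraph.fromRel_adj] at h
  obtain ⟨-, ⟨i, j, hij, rfl⟩ | ⟨i, j, hij, rfl⟩⟩ := h
  · exact ⟨i, j, hij, rfl⟩
  · exact ⟨i, j, hij, by ext; simp⟩

/-- Exchanging neighbours reverses only their own relative order. -/
theorem lt_swap_or {n : ℕ} {s : ListState n} {i j : Fin n} (hij : (j : ℕ) = (i : ℕ) + 1)
    {u v : Fin n} (h : s u < s v) :
    s.trans (Equiv.swap i j) u < s.trans (Equiv.swap i j) v ∨ (s u = i ∧ s v = j) := by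
  simp only [Equiv.trans_apply, Equiv.swap_apply_def]
  rw [Fin.lt_def] at h
  split_ifs <;> simp only [Fin.lt_def, Fin.ext_iff] at * <;> omega

theorem card_inversions_le_length {n : ℕ} {s t : ListState n} (p : (exchangeGraph n).Walk s t) :
    (inversions s t).card ≤ p.length := by
  induction p with
  | nil =>
    rw [SimpleGraph.Walk.length_nil, Nat.le_zero, Finset.card_eq_zero, Finset.eq_empty_iff_forall_notMem]
    rintro ⟨u, v⟩ h
    have := mem_inversions.1 h
    exact absurd this.1 this.2.asymm
  | @cons s s' t h p ih =>
    obtain ⟨i, j, hij, rfl⟩ := exchangeGraph_adj h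
    have hsub : inversions s t ⊆
        insert (s.symm i, s.symm j) (inversions (s.trans (Equiv.swap i j)) t) := by
      rintro ⟨u, v⟩ huv
      obtain ⟨h1, h2⟩ := mem_inversions.1 huv
      rw [Finset.mem_insert]
      rcases lt_swap_or hij h1 with h3 | ⟨h3, h4⟩
      · exact Or.inr (mem_inversions.2 ⟨h3, h2⟩)
      · left
        rw [← h3, ← h4]
        simp
    calc (inversions s t).card ≤ _ := Finset.card_le_card hsub
      _ ≤ (inversions (s.trans (Equiv.swap i j)) t).card + 1 := Finset.card_insert_le _ _
      _ ≤ _ := by rw [SimpleGraph.Walk.length_cons]; omega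

/-- Two different list states disagree on some two items which are neighbours in the first. -/
theorem exists_consecutive_inversion {n : ℕ} {s t : ListState n} (h : s ≠ t) :
    ∃ u v, (s v : ℕ) = s u + 1 ∧ t v < t u := by
  by_contra! hc
  apply h
  have hstep : ∀ a b : Fin n, (b : ℕ) = a + 1 → t (s.symm a) < t (s.symm b) := by
    intro a b hab
    refine lt_of_le_of_ne (hc _ _ (by simpa using hab)) fun he => ?_
    have := s.symm.injective (t.injective he)
    omega
  have hmono : StrictMono fun a => t (s.symm a) := by
    rcases n with _ | n
    · intro a
      exact a.elim0
    · rw [Fin.strictMono_iff_lt_succ]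
      intro i
      exact hstep _ _ (by simp)
  have hid : (fun a => t (s.symm a)) = id := by
    refine (StrictMono.range_inj hmono strictMono_id).1 ?_
    rw [Set.range_id, Set.range_eq_univ]
    exact t.surjective.comp s.symm.surjective
  ext u
  have := congrFun hid (s u)
  simp only [Equiv.symm_apply_apply, id] at this
  rw [this]

/-- Repeatedly exchanging neighbours in the wrong order leads from `s` to `t`; in particular, the
exchange graph is connected. -/
theorem exists_walk_card_inversions {n : ℕ} (t : ListState n) (m : ℕ) : ∀ s : ListState n,
    (inversions s t).card = m → ∃ p : (exchangeGraph n).Walk s t, p.length ≤ m := by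
  induction m with
  | zero =>
    intro s hs
    by_cases h : s = t
    · subst h
      exact ⟨.nil, le_rfl⟩
    · obtain ⟨u, v, huv, hvu⟩ := exists_consecutive_inversion h
      have : (u, v) ∈ inversions s t := mem_inversions.2 ⟨by rw [Fin.lt_def]; omega, hvu⟩
      rw [Finset.card_eq_zero.1 hs] at this
      simp at this
  | succ m ih =>
    intro s hs
    have h : s ≠ t := by
      rintro rfl
      have : (inversions s s).card ≤ 0 := card_inversions_le_length .nil
      omega
    obtain ⟨u, v, huv, hvu⟩ := exists_consecutive_inversion h
    set s' : ListState n := s.trans (Equiv.swap (s u) (s v)) with hs'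
    have hmem : (u, v) ∈ inversions s t := mem_inversions.2 ⟨by rw [Fin.lt_def]; omega, hvu⟩
    have hsub : inversions s' t ⊆ (inversions s t).erase (u, v) := by
      rintro ⟨a, b⟩ hab
      obtain ⟨h1, h2⟩ := mem_inversions.1 hab
      have hback : s = s'.trans (Equiv.swap (s u) (s v)) := by
        ext
        simp [hs']
      rw [Finset.mem_erase]
      have hne : (a, b) ≠ (u, v) := by
        rintro ⟨⟩
        simp only [hs', Equiv.trans_apply, Equiv.swap_apply_left, Equiv.swap_apply_right,
          Fin.lt_def] at h1
        omega
      refine ⟨hne, ?_⟩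
      rcases lt_swap_or (s := s') (i := s u) (j := s v) huv h1 with h3 | ⟨h3, h4⟩
      · rw [← hback] at h3
        exact mem_inversions.2 ⟨h3, h2⟩
      · have ha : a = v := by
          apply s'.injective
          rw [h3]
          simp [hs']
        have hb : b = u := by
          apply s'.injective
          rw [h4]
          simp [hs']
        subst ha hb
        exact absurd h2 hvu.asymm
    have hsub' : inversions s t ⊆ insert (u, v) (inversions s' t) := by
      rintro ⟨a, b⟩ hab
      obtain ⟨h1, h2⟩ := mem_inversions.1 hab
      rw [Finset.mem_insert]
      rcases lt_swap_or huv h1 with h3 | ⟨h3, h4⟩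
      · exact Or.inr (mem_inversions.2 ⟨h3, h2⟩)
      · exact Or.inl (Prod.ext (s.injective h3) (s.injective h4))
    have hc1 := Finset.card_le_card hsub
    have hc2 := Finset.card_le_card hsub'
    rw [Finset.card_erase_of_mem hmem] at hc1
    have hc3 := Finset.card_insert_le (u, v) (inversions s' t)
    obtain ⟨p, hp⟩ := ih s' (by omega)
    have hadj : (exchangeGraph n).Adj s s' := by
      rw [exchangeGraph, SimpleGraph.fromRel_adj]
      refine ⟨fun he => ?_, Or.inl ⟨_, _, huv, rfl⟩⟩
      have := congrArg (fun f : ListState n => ((f u : Fin n) : ℕ)) he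
      simp only [hs', Equiv.trans_apply, Equiv.swap_apply_left] at this
      omega
    exact ⟨.cons hadj p, by rw [SimpleGraph.Walk.length_cons]; omega⟩

theorem rearrangeCost_eq_card_inversions {n : ℕ} (s t : ListState n) :
    rearrangeCost s t = (inversions s t).card := by
  obtain ⟨p, hp⟩ := exists_walk_card_inversions t _ s rfl
  apply le_antisymm
  · exact (SimpleGraph.dist_le p).trans hp
  · obtain ⟨q, hq⟩ := p.reachable.exists_walk_length_eq_dist
    rw [rearrangeCost, ← hq]
    exact card_inversions_le_length q

theorem card_inFront {n : ℕ} (s : ListState n) (w : Fin n) :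
    (Finset.univ.filter fun u => s u < s w).card = (s w : ℕ) := by
  have : (Finset.univ.filter fun u => s u < s w) = (Finset.Iio (s w)).map s.symm.toEmbedding := by
    ext u
    simp
  rw [this, Finset.card_map, Fin.card_Iio]

/-- Rearranging the list before accessing an item cannot save cost: each paid exchange moves the
item by at most one position. -/
theorem position_le_rearrangeCost_add_accessCost {n : ℕ} (s t : ListState n) (w : Fin n) :
    (s w : ℕ) ≤ rearrangeCost s t + accessCost t w := by
  rw [rearrangeCost_eq_card_inversions, accessCost, ← card_inFront s, ← card_inFront t]
  have hsub : (Finset.univ.filter fun u => s u < s w) ⊆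
      (Finset.univ.filter fun u => t u < t w) ∪ (inversions s t).image Prod.fst := by
    intro u hu
    rw [Finset.mem_filter] at hu
    simp only [Finset.mem_union, Finset.mem_filter, Finset.mem_univ, true_and, Finset.mem_image,
      Prod.exists, exists_and_right, exists_eq_right]
    rcases lt_trichotomy (t u) (t w) with h | h | h
    · exact Or.inl h
    · rw [t.injective h] at hu
      exact absurd hu.2 (lt_irrefl _)
    · exact Or.inr ⟨w, mem_inversions.2 ⟨hu.2, h⟩⟩
  have h1 := Finset.card_le_card hsub
  have h2 := Finset.card_union_le (Finset.univ.filter fun u => t u < t w)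
    ((inversions s t).image Prod.fst)
  have h3 := Finset.card_image_le (s := inversions s t) (f := Prod.fst)
  omega

/-- Moving only the item `w`, and only towards the front, and then accessing it costs no more than
accessing it before the move. -/
theorem rearrangeCost_add_accessCost_le_position {n : ℕ} {s t : ListState n} {w : Fin n}
    (hothers : ∀ u v, u ≠ w → v ≠ w → s u < s v → t u < t v)
    (hfront : ∀ u, s w < s u → t w < t u) :
    rearrangeCost s t + accessCost t w ≤ s w := by
  rw [rearrangeCost_eq_card_inversions, accessCost, ← card_inFront s, ← card_inFront t]
  have hinj : Set.InjOn Prod.fst (inversions s t : Set (Fin n × Fin n)) ∧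
      ∀ p ∈ inversions s t, p.2 = w := by
    have key : ∀ p ∈ inversions s t, p.2 = w := by
      rintro ⟨u, v⟩ h
      obtain ⟨h1, h2⟩ := mem_inversions.1 h
      by_contra hv
      by_cases hu : u = w
      · subst hu
        exact absurd h2 (hfront v h1).asymm
      · exact absurd h2 (hothers u v hu hv h1).asymm
    refine ⟨fun p hp q hq hpq => Prod.ext hpq ?_, key⟩
    rw [key p hp, key q hq]
  rw [← Finset.card_image_of_injOn hinj.1, ← Finset.card_union_of_disjoint]
  · apply Finset.card_le_card
    intro u
    simp only [Finset.mem_union, Finset.mem_filter, Finset.mem_univ, true_and, Finset.mem_image,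
      Prod.exists, exists_and_right, exists_eq_right]
    rintro (⟨v, hv⟩ | hu)
    · have hvw : v = w := hinj.2 _ hv
      subst hvw
      exact (mem_inversions.1 hv).1
    · rcases lt_trichotomy (s u) (s w) with h | h | h
      · exact h
      · rw [s.injective h] at hu
        exact absurd hu (lt_irrefl _)
      · exact absurd hu (hfront u h).asymm
  · rw [Finset.disjoint_left]
    intro u hu hu'
    simp only [Finset.mem_filter, Finset.mem_univ, true_and, Finset.mem_image,
      Prod.exists, exists_and_right, exists_eq_right] at hu hu'
    obtain ⟨v, hv⟩ := hu
    have hvw : v = w := hinj.2 _ hv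
    subst hvw
    exact absurd hu' (mem_inversions.1 hv).2.asymm

/-! ### Projective algorithms on the rearrangements of a request sequence -/

theorem proj_append {n : ℕ} (x y : Fin n) (l₁ l₂ : List (Fin n)) :
    proj x y (l₁ ++ l₂) = proj x y l₁ ++ proj x y l₂ := by
  simp [proj]

theorem proj_cons_of_mem {n : ℕ} {x y a : Fin n} (h : a = x ∨ a = y) (l : List (Fin n)) :
    proj x y (a :: l) = a :: proj x y l := by
  simp [proj, h]

theorem proj_cons_of_not {n : ℕ} {x y a : Fin n} (h : ¬ (a = x ∨ a = y)) (l : List (Fin n)) :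
    proj x y (a :: l) = proj x y l := by
  simp [proj, h]

theorem count_proj_left {n : ℕ} (x y : Fin n) (l : List (Fin n)) :
    (proj x y l).count x = l.count x := by
  rw [proj, List.count_filter]
  simp

/-- Sequences on `{x, y}` and on `{x, z}` with equally many requests to `x` are the projections of
a common sequence. -/
theorem exists_merge {n : ℕ} {x y z : Fin n} (hxy : x ≠ y) (hxz : x ≠ z) (hyz : y ≠ z)
    (u : List (Fin n)) : ∀ v : List (Fin n), (∀ c ∈ u, c = x ∨ c = y) → (∀ c ∈ v, c = x ∨ c = z) →
      u.count x = v.count x → ∃ m, proj x y m = u ∧ proj x z m = v := by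
  have hz : ∀ as : List (Fin n), (∀ c ∈ as, c = x ∨ c = z) → x ∉ as →
      proj x y as = [] ∧ proj x z as = as := by
    intro as h hx
    refine ⟨?_, List.filter_eq_self.2 fun c hc => by simpa using h c hc⟩
    rw [proj, List.filter_eq_nil_iff]
    intro c hc
    have : c = z := (h c hc).resolve_left fun he => hx (he ▸ hc)
    simp [this, hxz.symm, hyz.symm]
  induction u with
  | nil =>
    intro v _ hv hc
    exact ⟨v, hz v hv (List.count_eq_zero.1 (by simpa using hc.symm))⟩
  | cons a u ih =>
    intro v hu hv hc
    rcases hu a (by simp) with rfl | rfl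
    · have hmem : a ∈ v := by
        rw [← List.count_pos_iff, ← hc, List.count_cons_self]
        omega
      obtain ⟨as, bs, rfl, has⟩ := List.eq_append_cons_of_mem hmem
      obtain ⟨m, hm1, hm2⟩ := ih bs (fun c h => hu c (by simp [h])) (fun c h => hv c (by simp [h])) (by
        rw [List.count_append, List.count_cons_self, List.count_cons_self,
          List.count_eq_zero.2 has] at hc
        omega)
      obtain ⟨h1, h2⟩ := hz as (fun c h => hv c (by simp [h])) has
      refine ⟨as ++ a :: m, ?_, ?_⟩
      · rw [proj_append, proj_cons_of_mem (Or.inl rfl), h1, hm1, List.nil_append]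
      · rw [proj_append, proj_cons_of_mem (Or.inl rfl), h2, hm2]
    · obtain ⟨m, hm1, hm2⟩ := ih v (fun c h => hu c (by simp [h])) hv (by
        rwa [List.count_cons_of_ne hxy.symm] at hc)
      refine ⟨a :: m, ?_, ?_⟩
      · rw [proj_cons_of_mem (Or.inr rfl), hm1]
      · rw [proj_cons_of_not (by simp [hxy.symm, hyz]), hm2]

theorem exists_split_at_count {n : ℕ} {x : Fin n} {l : List (Fin n)} : ∀ {m : ℕ}, m < l.count x →
    ∃ l₁ l₂, l = l₁ ++ x :: l₂ ∧ l₁.count x = m := by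
  induction l with
  | nil => intro m h; simp at h
  | cons a l ih =>
    intro m h
    by_cases ha : a = x
    · subst ha
      rcases m with _ | m
      · exact ⟨[], l, rfl, rfl⟩
      · obtain ⟨l₁, l₂, rfl, h2⟩ := ih (m := m) (by rw [List.count_cons_self] at h; omega)
        exact ⟨a :: l₁, l₂, rfl, by rw [List.count_cons_self, h2]⟩
    · obtain ⟨l₁, l₂, rfl, h2⟩ := ih (m := m) (by rwa [List.count_cons_of_ne ha] at h)
      exact ⟨a :: l₁, l₂, rfl, by rw [List.count_cons_of_ne ha, h2]⟩

theorem lt_iff_of_proj_eq {n : ℕ} {S : OnlineAlgorithm n} (hS : S.IsProjective) {x y : Fin n}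
    {l l' : List (Fin n)} (h : proj x y l = proj x y l') : S l x < S l y ↔ S l' x < S l' y := by
  rw [hS x y l, hS x y l', h]

/-- One half of `critical_request_unique`: if the request to `x` in the second exchange came later,
both exchanges could be made in one merged sequence. -/
theorem critical_request_not_lt {n : ℕ} {S : OnlineAlgorithm n} (hS : S.IsProjective)
    {x y z : Fin n} (hxy : x ≠ y) (hxz : x ≠ z) (hyz : y ≠ z) {α β α' β' : List (Fin n)}
    (h : ¬ (S (α ++ x :: y :: β) x < S (α ++ x :: y :: β) y ↔
      S (α ++ y :: x :: β) x < S (α ++ y :: x :: β) y))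
    (h' : ¬ (S (α' ++ x :: z :: β') x < S (α' ++ x :: z :: β') z ↔
      S (α' ++ z :: x :: β') x < S (α' ++ z :: x :: β') z))
    (hc : α.count x + β.count x = α'.count x + β'.count x) : ¬ α.count x < α'.count x := by
  intro hlt
  have hl : ∀ (y : Fin n) (l : List (Fin n)), ∀ c ∈ proj x y l, c = x ∨ c = y := by
    intro y l c hc
    simpa using (List.mem_filter.1 hc).2
  obtain ⟨A₁, A₂, hA, hA1⟩ := exists_split_at_count (l := proj x z α') (x := x) (m := α.count x)
    (by rwa [count_proj_left])
  obtain ⟨B₁, B₂, hB, hB1⟩ := exists_split_at_count (l := proj x y β) (x := x)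
    (m := α'.count x - α.count x - 1) (by rw [count_proj_left]; omega)
  have hA2 : A₂.count x = α'.count x - α.count x - 1 := by
    have := congrArg (List.count x) hA
    rw [count_proj_left, List.count_append, List.count_cons_self] at this
    omega
  have hB2 : B₂.count x = β'.count x := by
    have := congrArg (List.count x) hB
    rw [count_proj_left, List.count_append, List.count_cons_self] at this
    omega
  have hAl : ∀ c ∈ A₁ ++ x :: A₂, c = x ∨ c = z := hA ▸ hl z α'
  have hBl : ∀ c ∈ B₁ ++ x :: B₂, c = x ∨ c = y := hB ▸ hl y β
  obtain ⟨m₁, hm1, hm1'⟩ := exists_merge hxy hxz hyz (proj x y α) A₁ (hl y α)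
    (fun c h => hAl c (by simp [h])) (by rw [count_proj_left, hA1])
  obtain ⟨m₂, hm2, hm2'⟩ := exists_merge hxy hxz hyz B₁ A₂ (fun c h => hBl c (by simp [h]))
    (fun c h => hAl c (by simp [h])) (by rw [hB1, hA2])
  obtain ⟨m₃, hm3, hm3'⟩ := exists_merge hxy hxz hyz B₂ (proj x z β') (fun c h => hBl c (by simp [h]))
    (hl z β') (by rw [count_proj_left, hB2])
  -- Both exchanges take place in one common sequence, independently of each other.
  let W : List (Fin n) → List (Fin n) → List (Fin n) := fun p r => m₁ ++ (p ++ (m₂ ++ (r ++ m₃)))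
  have hzx : z ≠ x := hxz.symm
  have hyx : y ≠ x := hxy.symm
  have hpxy : ∀ p r, (r = [x, z] ∨ r = [z, x]) → (p = [x, y] ∨ p = [y, x]) →
      proj x y (W p r) = proj x y (α ++ (p ++ β)) := by
    intro p r hr hp
    have h1 : proj x y r = [x] := by
      rcases hr with rfl | rfl <;> simp [proj, hzx, hyz.symm]
    simp only [W, proj_append, hm1, hm2, hm3, h1, hB, List.singleton_append]
  have hpxz : ∀ p r, (r = [x, z] ∨ r = [z, x]) → (p = [x, y] ∨ p = [y, x]) →
      proj x z (W p r) = proj x z (α' ++ (r ++ β')) := by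
    intro p r hr hp
    have h1 : proj x z p = [x] := by
      rcases hp with rfl | rfl <;> simp [proj, hyx, hyz]
    simp only [W, proj_append, hm1', hm2', hm3', h1, hA, List.append_assoc, List.cons_append,
      List.nil_append]
  have hpyz : ∀ p r, (r = [x, z] ∨ r = [z, x]) → (p = [x, y] ∨ p = [y, x]) →
      proj y z (W p r) = proj y z (W [x, y] [x, z]) := by
    intro p r hr hp
    have h1 : proj y z r = [z] := by
      rcases hr with rfl | rfl <;> simp [proj, hxz, hxy]
    have h2 : proj y z p = [y] := by
      rcases hp with rfl | rfl <;> simp [proj, hxz, hxy]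
    have h3 : proj y z [x, z] = [z] := by simp [proj, hxz, hxy]
    have h4 : proj y z [x, y] = [y] := by simp [proj, hxz, hxy]
    simp only [W, proj_append, h1, h2, h3, h4]
  have e1 : ∀ p r, (r = [x, z] ∨ r = [z, x]) → (p = [x, y] ∨ p = [y, x]) →
      ((S (W p r) x < S (W p r) y ↔ S (α ++ (p ++ β)) x < S (α ++ (p ++ β)) y) ∧
       (S (W p r) x < S (W p r) z ↔ S (α' ++ (r ++ β')) x < S (α' ++ (r ++ β')) z) ∧
       (S (W p r) y < S (W p r) z ↔ S (W [x, y] [x, z]) y < S (W [x, y] [x, z]) z)) :=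
    fun p r hr hp => ⟨lt_iff_of_proj_eq hS (hpxy p r hr hp), lt_iff_of_proj_eq hS (hpxz p r hr hp),
      lt_iff_of_proj_eq hS (hpyz p r hr hp)⟩
  have hne : ∀ l, S l y ≠ S l z := fun l he => hyz ((S l).injective he)
  have hex : ∀ P : List (Fin n) → Prop, ∀ q q' : List (Fin n), ¬ (P q ↔ P q') →
      (∃ p, (p = q ∨ p = q') ∧ P p) ∧ ∃ p, (p = q ∨ p = q') ∧ ¬ P p := by
    intro P q q' hPq
    by_cases hq : P q
    · exact ⟨⟨q, Or.inl rfl, hq⟩, q', Or.inr rfl, fun hq' => hPq ⟨fun _ => hq', fun _ => hq⟩⟩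
    · exact ⟨⟨q', Or.inr rfl, by_contra fun hq' => hPq ⟨fun h => absurd h hq, fun h => absurd h hq'⟩⟩,
        q, Or.inl rfl, hq⟩
  obtain ⟨⟨p, hp, hpT⟩, p', hp', hpF⟩ :=
    hex (fun p => S (α ++ (p ++ β)) x < S (α ++ (p ++ β)) y) [x, y] [y, x] h
  obtain ⟨⟨r, hr, hrT⟩, r', hr', hrF⟩ :=
    hex (fun r => S (α' ++ (r ++ β')) x < S (α' ++ (r ++ β')) z) [x, z] [z, x] h'
  by_cases H : S (W [x, y] [x, z]) y < S (W [x, y] [x, z]) z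
  · obtain ⟨h1, h2, h3⟩ := e1 p r' hr' hp
    exact hrF (h2.1 ((h1.2 hpT).trans (h3.2 H)))
  · obtain ⟨h1, h2, h3⟩ := e1 p' r hr hp'
    exact hpF (h1.1 ((h2.2 hrT).trans (lt_of_le_of_ne (not_lt.1 fun h => H (h3.1 h)) (hne _).symm)))

/-- The critical request to `x` does not depend on the other item: if exchanging neighbouring
requests to `x` and `y` changes the order of `x` and `y`, and likewise for `x` and `z`, then the
same request to `x` is involved. Otherwise `z` could be moved past `x`, but not past `y`, at a time
when `x` and `y` have to be neighbours in the list. -/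
theorem critical_request_unique {n : ℕ} {S : OnlineAlgorithm n} (hS : S.IsProjective)
    {x y z : Fin n} (hxy : x ≠ y) (hxz : x ≠ z) (hyz : y ≠ z) {α β α' β' : List (Fin n)}
    (h : ¬ (S (α ++ x :: y :: β) x < S (α ++ x :: y :: β) y ↔
      S (α ++ y :: x :: β) x < S (α ++ y :: x :: β) y))
    (h' : ¬ (S (α' ++ x :: z :: β') x < S (α' ++ x :: z :: β') z ↔
      S (α' ++ z :: x :: β') x < S (α' ++ z :: x :: β') z))
    (hc : α.count x + β.count x = α'.count x + β'.count x) : α.count x = α'.count x :=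
  le_antisymm (not_lt.1 (critical_request_not_lt hS hxz hxy hyz.symm h' h hc.symm))
    (not_lt.1 (critical_request_not_lt hS hxy hxz hyz h h' hc))

/-- A property of a list which is not affected by exchanges of neighbours in its middle part is not
affected by permutations of this part. -/
theorem iff_of_perm {ι : Type*} {f : List ι → Prop} {l₁ l₂ : List ι} (h : l₁.Perm l₂) :
    ∀ pre suf : List ι, (∀ a p q b, (a ++ p :: q :: b).Perm l₁ →
      (f (pre ++ (a ++ p :: q :: b) ++ suf) ↔ f (pre ++ (a ++ q :: p :: b) ++ suf))) →
      (f (pre ++ l₁ ++ suf) ↔ f (pre ++ l₂ ++ suf)) := by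
  induction h with
  | nil => intros; rfl
  | cons x h ih =>
    intro pre suf hs
    have := ih (pre ++ [x]) suf fun a p q b hp => by
      simpa using hs (x :: a) p q b (by simpa using hp)
    simpa using this
  | swap x y l =>
    intro pre suf hs
    exact hs [] y x l (List.Perm.refl _)
  | trans h1 h2 ih1 ih2 =>
    intro pre suf hs
    exact (ih1 pre suf hs).trans (ih2 pre suf fun a p q b hp => hs a p q b (hp.trans h1.symm))

theorem lt_iff_swap_of_ne {n : ℕ} {S : OnlineAlgorithm n} (hS : S.IsProjective) {x y p q : Fin n}
    (h1 : ¬ (p = x ∧ q = y)) (h2 : ¬ (p = y ∧ q = x)) (a b : List (Fin n)) :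
    S (a ++ p :: q :: b) x < S (a ++ p :: q :: b) y ↔
      S (a ++ q :: p :: b) x < S (a ++ q :: p :: b) y := by
  apply lt_iff_of_proj_eq hS
  rw [proj_append, proj_append]
  congr 1
  by_cases hpq : p = q
  · rw [hpq]
  · by_cases hp : p = x ∨ p = y
    · have hq : ¬ (q = x ∨ q = y) := by
        rintro (rfl | rfl) <;> rcases hp with rfl | rfl <;> simp_all
      rw [proj_cons_of_mem hp, proj_cons_of_not hq, proj_cons_of_not hq, proj_cons_of_mem hp]
    · by_cases hq : q = x ∨ q = y
      · rw [proj_cons_of_mem hq, proj_cons_of_not hp, proj_cons_of_not hp, proj_cons_of_mem hq]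
      · rw [proj_cons_of_not hp, proj_cons_of_not hq, proj_cons_of_not hq, proj_cons_of_not hp]

/-- Unless the order of `x` and `y` is the same for all rearrangements of `W₀`, it is changed by the
exchange of some neighbouring requests to `x` and `y`. -/
theorem constant_or_exists_flip {n : ℕ} {S : OnlineAlgorithm n} (hS : S.IsProjective) (x y : Fin n)
    (W₀ : List (Fin n)) :
    (∀ W W' : List (Fin n), W.Perm W₀ → W'.Perm W₀ → (S W x < S W y ↔ S W' x < S W' y)) ∨
    ∃ α β, (α ++ x :: y :: β).Perm W₀ ∧ ¬ (S (α ++ x :: y :: β) x < S (α ++ x :: y :: β) y ↔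
      S (α ++ y :: x :: β) x < S (α ++ y :: x :: β) y) := by
  by_contra! hc
  obtain ⟨⟨W, W', hW, hW', hne⟩, hno⟩ := hc
  have key := iff_of_perm (f := fun l => S l x < S l y) (hW.trans hW'.symm) [] [] (by
    intro a p q b hp
    simp only [List.nil_append, List.append_nil]
    by_cases h1 : p = x ∧ q = y
    · obtain ⟨rfl, rfl⟩ := h1
      exact hno a b (hp.trans hW)
    · by_cases h2 : p = y ∧ q = x
      · obtain ⟨rfl, rfl⟩ := h2
        exact (hno a b ((List.Perm.append_left a (List.Perm.swap _ _ _)).trans (hp.trans hW))).symm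
      · exact lt_iff_swap_of_ne hS h1 h2 a b)
  simp only [List.nil_append, List.append_nil] at key
  rcases hne with ⟨h1, h2⟩ | ⟨h1, h2⟩
  · exact absurd (key.1 h1) h2.not_gt
  · exact absurd (key.2 h2) h1.not_gt

/-- The critical requests of a projective algorithm. For the rearrangements of a sequence `W₀`, if
the orders of `x, z` and of `y, z` are not constant, then there are a request to `x` and a request to
`y` (with `a` and `b` previous ones) so that the order of `x` and `y` depends only on which of these
two requests comes later. -/
theorem exists_critical_requests {n : ℕ} {S : OnlineAlgorithm n} (hS : S.IsProjective)
    {x y z : Fin n} (hxy : x ≠ y) (hxz : x ≠ z) (hyz : y ≠ z) (W₀ : List (Fin n)) :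
    (∀ W W' : List (Fin n), W.Perm W₀ → W'.Perm W₀ → (S W x < S W z ↔ S W' x < S W' z)) ∨
    (∀ W W' : List (Fin n), W.Perm W₀ → W'.Perm W₀ → (S W y < S W z ↔ S W' y < S W' z)) ∨
    ∃ a b, a < W₀.count x ∧ b < W₀.count y ∧ ∃ v₁ v₂ : Prop, ∀ W₁ W₂, (W₁ ++ W₂).Perm W₀ →
      (W₁.count x ≤ a → b < W₁.count y → (S (W₁ ++ W₂) x < S (W₁ ++ W₂) y ↔ v₁)) ∧
      (a < W₁.count x → W₁.count y ≤ b → (S (W₁ ++ W₂) x < S (W₁ ++ W₂) y ↔ v₂)) := by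
  rcases constant_or_exists_flip hS x z W₀ with h | ⟨α, β, hαβ, hf⟩
  · exact Or.inl h
  rcases constant_or_exists_flip hS y z W₀ with h | ⟨α', β', hαβ', hf'⟩
  · exact Or.inr (Or.inl h)
  refine Or.inr (Or.inr ⟨α.count x, α'.count y, ?_, ?_, ?_⟩)
  · rw [← hαβ.count_eq, List.count_append, List.count_cons_self]
    omega
  · rw [← hαβ'.count_eq, List.count_append, List.count_cons_self]
    omega
  have hsymm : ∀ l, S l y < S l x ↔ ¬ S l x < S l y := fun l => by
    rw [not_lt]
    exact ⟨le_of_lt, fun h => lt_of_le_of_ne h fun he => hxy ((S l).injective he).symm⟩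
  have hunique : ∀ γ δ, (γ ++ x :: y :: δ).Perm W₀ →
      ¬ (γ.count x = α.count x ∧ γ.count y = α'.count y) →
      (S (γ ++ x :: y :: δ) x < S (γ ++ x :: y :: δ) y ↔
        S (γ ++ y :: x :: δ) x < S (γ ++ y :: x :: δ) y) := by
    intro γ δ hp hne
    by_contra hflip
    refine hne ⟨critical_request_unique hS hxy hxz hyz hflip hf ?_,
      critical_request_unique hS hxy.symm hyz hxz (α := γ) (β := δ) ?_ hf' ?_⟩
    · have := (hp.trans hαβ.symm).count_eq x
      simp [hxy.symm, hxz.symm] at this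
      omega
    · rw [hsymm, hsymm]
      tauto
    · have := (hp.trans hαβ'.symm).count_eq y
      simp [hxy, hyz.symm] at this
      omega
  have hswap : ∀ γ δ p q, (γ ++ p :: q :: δ).Perm W₀ →
      ¬ (γ.count x = α.count x ∧ γ.count y = α'.count y) →
      (S (γ ++ p :: q :: δ) x < S (γ ++ p :: q :: δ) y ↔
        S (γ ++ q :: p :: δ) x < S (γ ++ q :: p :: δ) y) := by
    intro γ δ p q hp hne
    by_cases h1 : p = x ∧ q = y
    · obtain ⟨rfl, rfl⟩ := h1
      exact hunique γ δ hp hne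
    · by_cases h2 : p = y ∧ q = x
      · obtain ⟨rfl, rfl⟩ := h2
        exact (hunique γ δ ((List.Perm.append_left γ (List.Perm.swap _ _ _)).trans hp) hne).symm
      · exact lt_iff_swap_of_ne hS h1 h2 γ δ
  -- No exchange of neighbours matters as long as the later one of the two requests stays later.
  have hfree : ∀ W₁ W₂ l l', (W₁ ++ l ++ W₂).Perm W₀ → l.Perm l' →
      (α.count x < (W₁ ++ l).count x → (W₁ ++ l).count y ≤ α'.count y ∨ α.count x < W₁.count x ∨
        α'.count y < W₁.count y) →
      (α'.count y < (W₁ ++ l).count y → (W₁ ++ l).count x ≤ α.count x ∨ α.count x < W₁.count x ∨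
        α'.count y < W₁.count y) →
      (S (W₁ ++ l ++ W₂) x < S (W₁ ++ l ++ W₂) y ↔ S (W₁ ++ l' ++ W₂) x < S (W₁ ++ l' ++ W₂) y) := by
    intro W₁ W₂ l l' hp hl hx hy
    refine iff_of_perm (f := fun l => S l x < S l y) hl W₁ W₂ ?_
    intro a p q b hab
    by_cases hcrit : (W₁ ++ a).count x = α.count x ∧ (W₁ ++ a).count y = α'.count y
    · by_cases h1 : (p = x ∧ q = y) ∨ (p = y ∧ q = x)
      · exfalso
        have hcx := hab.count_eq x
        have hcy := hab.count_eq y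
        simp only [List.count_append] at hcrit hx hy hcx hcy
        rcases h1 with ⟨rfl, rfl⟩ | ⟨rfl, rfl⟩
        · rw [List.count_cons_self, List.count_cons_of_ne hxy.symm] at hcx
          rw [List.count_cons_of_ne hxy, List.count_cons_self] at hcy
          omega
        · rw [List.count_cons_self, List.count_cons_of_ne hxy] at hcy
          rw [List.count_cons_of_ne hxy.symm, List.count_cons_self] at hcx
          omega
      · rw [not_or] at h1
        have := lt_iff_swap_of_ne hS h1.1 h1.2 (W₁ ++ a) (b ++ W₂)
        simpa using this
    · have := hswap (W₁ ++ a) (b ++ W₂) p q ?_ hcrit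
      · simpa using this
      · refine List.Perm.trans ?_ hp
        have := (List.Perm.append_left W₁ hab).append_right W₂
        simpa using this
  have hcanon : ∀ (w : Fin n) (c : ℕ) W₁ W₂ W₁' W₂', (W₁ ++ W₂).Perm W₀ → (W₁' ++ W₂').Perm W₀ →
      (w = y ∧ c = α'.count y ∧ W₁.count x ≤ α.count x ∧ W₁'.count x ≤ α.count x ∨
        w = x ∧ c = α.count x ∧ W₁.count y ≤ α'.count y ∧ W₁'.count y ≤ α'.count y) →
      c < W₁.count w → c < W₁'.count w →
      (S (W₁ ++ W₂) x < S (W₁ ++ W₂) y ↔ S (W₁' ++ W₂') x < S (W₁' ++ W₂') y) := by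
    intro w c W₁ W₂ W₁' W₂' hp hp' hw h1 h1'
    have step : ∀ W₁ W₂, (W₁ ++ W₂).Perm W₀ → c < W₁.count w →
        (w = y ∧ c = α'.count y ∧ W₁.count x ≤ α.count x ∨
          w = x ∧ c = α.count x ∧ W₁.count y ≤ α'.count y) →
        ∃ R, W₁.Perm (List.replicate (c + 1) w ++ R) ∧ (S (W₁ ++ W₂) x < S (W₁ ++ W₂) y ↔
          S (List.replicate (c + 1) w ++ R ++ W₂) x < S (List.replicate (c + 1) w ++ R ++ W₂) y) := by
      intro W₁ W₂ hp h1 hw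
      obtain ⟨R, hR⟩ := (List.replicate_sublist_iff.2 h1).exists_perm_append
      refine ⟨R, hR, ?_⟩
      have := hfree [] W₂ W₁ _ (by simpa using hp) hR (by
        simp only [List.nil_append]
        intro h
        rcases hw with hw | hw <;> omega) (by
        simp only [List.nil_append]
        intro h
        rcases hw with hw | hw <;> omega)
      simpa only [List.nil_append] using this
    obtain ⟨R, hR, hRi⟩ := step W₁ W₂ hp h1 (by tauto)
    obtain ⟨R', hR', hRi'⟩ := step W₁' W₂' hp' h1' (by tauto)
    rw [hRi, hRi', List.append_assoc, List.append_assoc]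
    have e1 : (List.replicate (c + 1) w ++ (R ++ W₂)).Perm W₀ := by
      rw [← List.append_assoc]
      exact (hR.append_right W₂).symm.trans hp
    have e2 : (List.replicate (c + 1) w ++ (R' ++ W₂')).Perm W₀ := by
      rw [← List.append_assoc]
      exact (hR'.append_right W₂').symm.trans hp'
    have hl : (R ++ W₂).Perm (R' ++ W₂') := (List.perm_append_left_iff _).1 (e1.trans e2.symm)
    have hcnt : α.count x < (List.replicate (c + 1) w).count x ∨
        α'.count y < (List.replicate (c + 1) w).count y := by
      rcases hw with ⟨rfl, hc, -⟩ | ⟨rfl, hc, -⟩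
      · right
        rw [List.count_replicate_self]
        omega
      · left
        rw [List.count_replicate_self]
        omega
    have := hfree (List.replicate (c + 1) w) [] _ _ (by simpa using e1) hl
      (fun _ => Or.inr hcnt) (fun _ => Or.inr hcnt)
    simpa only [List.append_nil] using this
  refine ⟨∃ W₁ W₂, (W₁ ++ W₂).Perm W₀ ∧ W₁.count x ≤ α.count x ∧ α'.count y < W₁.count y ∧
      S (W₁ ++ W₂) x < S (W₁ ++ W₂) y, ∃ W₁ W₂, (W₁ ++ W₂).Perm W₀ ∧ α.count x < W₁.count x ∧
      W₁.count y ≤ α'.count y ∧ S (W₁ ++ W₂) x < S (W₁ ++ W₂) y, ?_⟩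
  intro W₁ W₂ hp
  refine ⟨fun hx hy => ⟨fun h => ⟨W₁, W₂, hp, hx, hy, h⟩, ?_⟩,
    fun hx hy => ⟨fun h => ⟨W₁, W₂, hp, hx, hy, h⟩, ?_⟩⟩
  · rintro ⟨V₁, V₂, hp', hx', hy', h⟩
    exact (hcanon y _ W₁ W₂ V₁ V₂ hp hp' (Or.inl ⟨rfl, rfl, hx, hx'⟩) hy hy').2 h
  · rintro ⟨V₁, V₂, hp', hx', hy', h⟩
    exact (hcanon x _ W₁ W₂ V₁ V₂ hp hp' (Or.inr ⟨rfl, rfl, hy, hy'⟩) hx hx').2 h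

/-! ### The lower bound at a single point -/

/-- The sum of `φ (V ++ p) w` over all splittings `l = p ++ w :: _`: the total of the costs
`φ history request` while the requests `l` are served after the history `V`. -/
def sumAlong {ι : Type*} (φ : List ι → ι → ℕ) : List ι → List ι → ℕ
  | _, [] => 0
  | V, w :: l => φ V w + sumAlong φ (V ++ [w]) l

theorem sumAlong_append {ι : Type*} (φ : List ι → ι → ℕ) (l₁ l₂ : List ι) : ∀ V : List ι,
    sumAlong φ V (l₁ ++ l₂) = sumAlong φ V l₁ + sumAlong φ (V ++ l₁) l₂ := by
  induction l₁ with
  | nil => intro V; simp [sumAlong]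
  | cons a l₁ ih =>
    intro V
    rw [List.cons_append, sumAlong, ih, sumAlong]
    simp [add_assoc]

theorem le_sumAlong_replicate {ι : Type*} {φ : List ι → ι → ℕ} {w : ι} {f m : ℕ} (hf : f ≤ m) :
    ∀ V : List ι, (∀ r < f, 1 ≤ φ (V ++ List.replicate r w) w) →
      f ≤ sumAlong φ V (List.replicate m w) := by
  induction m generalizing f with
  | zero => intro V _; omega
  | succ m ih =>
    intro V h
    rcases f with _ | f
    · omega
    rw [List.replicate_succ, sumAlong]
    have h0 := h 0 (by omega)
    have h1 := ih (f := f) (by omega) (V ++ [w]) fun r hr => by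
      have := h (r + 1) (by omega)
      rw [List.replicate_succ] at this
      simpa using this
    simp only [List.replicate_zero, List.append_nil] at h0
    omega

theorem sub_le_sumAlong_replicate {ι : Type*} {φ : List ι → ι → ℕ} {w : ι} {f m : ℕ} (V : List ι)
    (h : ∀ r, f ≤ r → r < m → 1 ≤ φ (V ++ List.replicate r w) w) :
    m - f ≤ sumAlong φ V (List.replicate m w) := by
  by_cases hf : f ≤ m
  · have hm : List.replicate m w = List.replicate f w ++ List.replicate (m - f) w := by
      rw [List.replicate_append_replicate]
      congr 1
      omega
    rw [hm, sumAlong_append]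
    have := le_sumAlong_replicate (φ := φ) (w := w) le_rfl (f := m - f) (V ++ List.replicate f w)
      fun r hr => by
        rw [List.append_assoc, List.replicate_append_replicate]
        exact h _ (by omega) (by omega)
    omega
  · omega

/-- One cycle of the hard request sequences. -/
def hardCycle {ι : Type*} (x y : ι) (P : ℕ) : List ι :=
  List.replicate P x ++ ([y] ++ (List.replicate P x ++ (List.replicate P y ++ ([x] ++
    List.replicate P y))))

/-- The fixed part of the hard request sequences, which follows after initial requests of varying
numbers to each of the three items. The first five runs make all algorithms pay whose order of the
items is not determined by the last `P` requests to each of them, or which move items with later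
critical requests to the back; for the latter, one run has the double length. -/
def hardTail {ι : Type*} (x y z : ι) (P T : ℕ) : List ι :=
  List.replicate P z ++ (List.replicate P x ++ (List.replicate P y ++ (List.replicate P x ++
    (List.replicate (2 * P) y ++ ((List.replicate T (hardCycle x y P)).flatten ++
      (List.replicate T [x, y]).flatten)))))

section Critical

variable {ι : Type*} [DecidableEq ι] {φ : List ι → ι → ℕ} {x y : ι} {P fx fy : ℕ}
  {Adm : List ι → Prop}

/-- The cost of one cycle for an algorithm which has `x` in front of `y` exactly if the critical
request to `x`, after which there are `fx < P` further ones, comes later than the critical request to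
`y`, after which there are `fy < P`. The hypotheses `hy` and `hx` say this in terms of a suffix of the
history that contains the critical request to only one of the two items; then the other one costs at
least `1`. -/
theorem le_sumAlong_hardCycle (hxy : x ≠ y) (hadm : ∀ V l, Adm (V ++ l) → Adm V)
    (hy : ∀ V₁ V₂, Adm (V₁ ++ V₂) → fx < V₂.count x → V₂.count y ≤ fy → 1 ≤ φ (V₁ ++ V₂) y)
    (hx : ∀ V₁ V₂, Adm (V₁ ++ V₂) → fy < V₂.count y → V₂.count x ≤ fx → 1 ≤ φ (V₁ ++ V₂) x)
    (hfx : fx < P) (hfy : fy < P) (V : List ι)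
    (hV : Adm (V ++ List.replicate P y ++ hardCycle x y P)) :
    (fx + 1) + 1 + (if fy = 0 then fx + 1 else 0) + (fy + 1) + 1 + (if fx = 0 then fy + 1 else 0) ≤
      sumAlong φ (V ++ List.replicate P y) (hardCycle x y P) := by
  have hyx : y ≠ x := hxy.symm
  have hrun : ∀ (V : List ι) (w : ι) (r m : ℕ), r < m → Adm (V ++ List.replicate m w) →
      Adm (V ++ List.replicate r w) := by
    intro V w r m hr h
    apply hadm _ (List.replicate (m - r) w)
    rw [List.append_assoc, List.replicate_append_replicate]
    rwa [show r + (m - r) = m by omega]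
  have hcx : ∀ m, (List.replicate m x).count x = m := fun m => List.count_replicate_self
  have hcy : ∀ m, (List.replicate m y).count y = m := fun m => List.count_replicate_self
  have hcxy : ∀ m, (List.replicate m x).count y = 0 := fun m => by
    rw [List.count_replicate]; simp [hxy]
  have hcyx : ∀ m, (List.replicate m y).count x = 0 := fun m => by
    rw [List.count_replicate]; simp [hyx]
  unfold hardCycle at hV ⊢
  set U := V ++ List.replicate P y with hU
  set U₁ := U ++ List.replicate P x with hU₁
  set U₂ := U₁ ++ [y] with hU₂
  set U₃ := U₂ ++ List.replicate P x with hU₃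
  set U₄ := U₃ ++ List.replicate P y with hU₄
  set U₅ := U₄ ++ [x] with hU₅
  simp only [← List.append_assoc] at hV
  simp only [sumAlong_append]
  simp only [← hU₁, ← hU₂, ← hU₃, ← hU₄, ← hU₅] at hV ⊢
  have A₅ := hadm _ _ hV
  have A₄ := hadm _ _ A₅
  have A₃ := hadm _ _ A₄
  have A₂ := hadm _ _ A₃
  have A₁ := hadm _ _ A₂
  have s₁ : fx + 1 ≤ sumAlong φ U (List.replicate P x) := by
    refine le_sumAlong_replicate hfx U fun r hr => ?_
    have := hx V (List.replicate P y ++ List.replicate r x)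
    rw [List.count_append, List.count_append, hcy, hcxy, hcyx, hcx, ← List.append_assoc, ← hU] at this
    exact this (hrun _ _ _ _ (by omega) A₁) (by omega) (by omega)
  have s₂ : 1 ≤ sumAlong φ U₁ [y] := by
    have := hy U (List.replicate P x) A₁
    rw [hcx, hcxy, ← hU₁] at this
    exact (this (by omega) (by omega)).trans (Nat.le_add_right _ _)
  have s₃ : (if fy = 0 then fx + 1 else 0) ≤ sumAlong φ U₂ (List.replicate P x) := by
    split_ifs with h
    · refine le_sumAlong_replicate hfx U₂ fun r hr => ?_
      have := hx U₁ ([y] ++ List.replicate r x)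
      rw [List.count_append, List.count_append, hcxy, hcx, ← List.append_assoc, ← hU₂] at this
      exact this (hrun _ _ _ _ (by omega) A₃) (by simp; omega) (by simp [hyx]; omega)
    · omega
  have s₄ : fy + 1 ≤ sumAlong φ U₃ (List.replicate P y) := by
    refine le_sumAlong_replicate hfy U₃ fun r hr => ?_
    have := hy U₂ (List.replicate P x ++ List.replicate r y)
    rw [List.count_append, List.count_append, hcy, hcxy, hcyx, hcx, ← List.append_assoc, ← hU₃] at this
    exact this (hrun _ _ _ _ (by omega) A₄) (by omega) (by omega)
  have s₅ : 1 ≤ sumAlong φ U₄ [x] := by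
    have := hx U₃ (List.replicate P y) A₄
    rw [hcy, hcyx, ← hU₄] at this
    exact (this (by omega) (by omega)).trans (Nat.le_add_right _ _)
  have s₆ : (if fx = 0 then fy + 1 else 0) ≤ sumAlong φ U₅ (List.replicate P y) := by
    split_ifs with h
    · refine le_sumAlong_replicate hfy U₅ fun r hr => ?_
      have := hy U₄ ([x] ++ List.replicate r y)
      rw [List.count_append, List.count_append, hcyx, hcy, ← List.append_assoc, ← hU₅] at this
      exact this (hrun _ _ _ _ (by omega) hV) (by simp; omega) (by simp [hxy]; omega)
    · omega
  omega

theorem le_sumAlong_hardCycles (hxy : x ≠ y) (hadm : ∀ V l, Adm (V ++ l) → Adm V)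
    (hy : ∀ V₁ V₂, Adm (V₁ ++ V₂) → fx < V₂.count x → V₂.count y ≤ fy → 1 ≤ φ (V₁ ++ V₂) y)
    (hx : ∀ V₁ V₂, Adm (V₁ ++ V₂) → fy < V₂.count y → V₂.count x ≤ fx → 1 ≤ φ (V₁ ++ V₂) x)
    (hfx : fx < P) (hfy : fy < P) (T : ℕ) : ∀ V : List ι,
    Adm (V ++ List.replicate P y ++ (List.replicate T (hardCycle x y P)).flatten) →
    T * ((fx + 1) + 1 + (if fy = 0 then fx + 1 else 0) + (fy + 1) + 1 +
      (if fx = 0 then fy + 1 else 0)) ≤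
      sumAlong φ (V ++ List.replicate P y) (List.replicate T (hardCycle x y P)).flatten ∧
    ∃ V', V ++ List.replicate P y ++ (List.replicate T (hardCycle x y P)).flatten =
      V' ++ List.replicate P y := by
  induction T with
  | zero => intro V _; simp
  | succ T ih =>
    intro V hV
    rw [List.replicate_succ, List.flatten_cons] at hV ⊢
    rw [sumAlong_append]
    rw [← List.append_assoc] at hV ⊢
    have h1 := le_sumAlong_hardCycle hxy hadm hy hx hfx hfy V (hadm _ _ hV)
    have hend : ∃ V', V ++ List.replicate P y ++ hardCycle x y P = V' ++ List.replicate P y :=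
      ⟨V ++ List.replicate P y ++ (List.replicate P x ++ ([y] ++ (List.replicate P x ++
        (List.replicate P y ++ [x])))), by simp [hardCycle]⟩
    obtain ⟨V', hV'⟩ := hend
    rw [hV'] at hV ⊢
    obtain ⟨h2, h3⟩ := ih V' hV
    refine ⟨?_, h3⟩
    rw [Nat.succ_mul]
    omega

theorem count_alternating (hxy : x ≠ y) (t : ℕ) :
    (List.replicate t [x, y]).flatten.count x = t ∧
      (List.replicate t [x, y]).flatten.count y = t := by
  induction t with
  | zero => simp
  | succ t ih =>
    rw [List.replicate_succ, List.flatten_cons, List.count_append, List.count_append, ih.1, ih.2]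
    simp [hxy, hxy.symm]
    omega

theorem alternating_add {ι : Type*} (x y : ι) (s t : ℕ) :
    (List.replicate (s + t) [x, y]).flatten =
      (List.replicate s [x, y]).flatten ++ (List.replicate t [x, y]).flatten := by
  rw [← List.replicate_append_replicate, List.flatten_append]

/-- The alternations cost such an algorithm `1` per pair of requests, and `2` if `fx = fy`, except
that the first `fx` pairs are too close to the preceding run of `y`. -/
theorem le_sumAlong_alternating (hxy : x ≠ y) (hadm : ∀ V l, Adm (V ++ l) → Adm V)
    (hy : ∀ V₁ V₂, Adm (V₁ ++ V₂) → fx < V₂.count x → V₂.count y ≤ fy → 1 ≤ φ (V₁ ++ V₂) y)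
    (hx : ∀ V₁ V₂, Adm (V₁ ++ V₂) → fy < V₂.count y → V₂.count x ≤ fx → 1 ≤ φ (V₁ ++ V₂) x)
    (hfy : fy < P) (V : List ι) (T : ℕ)
    (hV : Adm (V ++ List.replicate P y ++ (List.replicate T [x, y]).flatten)) :
    (if fy ≤ fx then T else 0) + (if fx ≤ fy then T - fx else 0) ≤
      sumAlong φ (V ++ List.replicate P y) (List.replicate T [x, y]).flatten := by
  induction T with
  | zero => simp
  | succ T ih =>
    rw [alternating_add] at hV ⊢
    rw [← List.append_assoc] at hV
    have ih' := ih (hadm _ _ hV)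
    rw [sumAlong_append]
    set U := V ++ List.replicate P y ++ (List.replicate T [x, y]).flatten with hU
    have hone : (List.replicate 1 [x, y]).flatten = [x] ++ [y] := by simp
    rw [hone] at hV ⊢
    rw [← List.append_assoc] at hV
    rw [sumAlong_append]
    have s₁ : (if fy ≤ fx then 1 else 0) ≤ sumAlong φ U [x] := by
      split_ifs with h
      · refine le_trans ?_ (Nat.le_add_right _ _)
        by_cases hT : T ≤ fy
        · have := hx V (List.replicate P y ++ (List.replicate T [x, y]).flatten)
          rw [← List.append_assoc, ← hU, List.count_append, List.count_append,
            (count_alternating hxy T).1, (count_alternating hxy T).2, List.count_replicate_self,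
            List.count_replicate] at this
          exact this (hadm _ _ (hadm _ _ hV)) (by omega) (by simp [hxy.symm]; omega)
        · -- Leave out the request to `x` at the start of the last `fy + 1` pairs.
          have hsplit : U = (V ++ List.replicate P y ++
              (List.replicate (T - (fy + 1)) [x, y]).flatten ++ [x]) ++
              ([y] ++ (List.replicate fy [x, y]).flatten) := by
            rw [hU]
            conv_lhs => rw [show T = (T - (fy + 1)) + (1 + fy) by omega]
            rw [alternating_add, alternating_add, hone]
            simp
          have := hx _ _ (hsplit ▸ hadm _ _ (hadm _ _ hV)) (by
            rw [List.count_append, (count_alternating hxy fy).2]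
            simp) (by
            rw [List.count_append, (count_alternating hxy fy).1]
            simp [hxy.symm]
            omega)
          rwa [← hsplit] at this
      · omega
    have s₂ : (if fx ≤ fy then (T + 1 - fx) - (T - fx) else 0) ≤ sumAlong φ (U ++ [x]) [y] := by
      split_ifs with h
      · by_cases hT : fx ≤ T
        · refine le_trans ?_ (Nat.le_add_right _ _)
          have hsplit : U ++ [x] = (V ++ List.replicate P y ++
              (List.replicate (T - fx) [x, y]).flatten) ++
              ((List.replicate fx [x, y]).flatten ++ [x]) := by
            rw [hU]
            conv_lhs => rw [show T = (T - fx) + fx by omega]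
            rw [alternating_add]
            simp
          have := hy _ _ (hsplit ▸ hadm _ _ hV) (by
            rw [List.count_append, (count_alternating hxy fx).1]
            simp) (by
            rw [List.count_append, (count_alternating hxy fx).2]
            simp [hxy]
            omega)
          rw [← hsplit] at this
          omega
        · omega
      · omega
    split_ifs at * <;> omega

end Critical

/-- One of the two critical requests comes first: there is a prefix which contains the `(b + 1)`-th
request to `y` but not the `(a + 1)`-th request to `x`, or the other way round. -/
theorem exists_prefix_deciding {ι : Type*} [DecidableEq ι] {x y : ι} (hxy : x ≠ y) {a b : ℕ}
    (W : List ι) (h : a < W.count x) : ∃ W₁ W₂, W = W₁ ++ W₂ ∧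
      ((W₁.count x ≤ a ∧ b < W₁.count y) ∨ (a < W₁.count x ∧ W₁.count y ≤ b)) := by
  induction W using List.reverseRecOn with
  | nil => simp at h
  | append_singleton W w ih =>
    by_cases hW : a < W.count x
    · obtain ⟨W₁, W₂, rfl, h'⟩ := ih hW
      exact ⟨W₁, W₂ ++ [w], by simp, h'⟩
    · by_cases hb : b < W.count y
      · exact ⟨W, [w], rfl, Or.inl ⟨not_lt.1 hW, hb⟩⟩
      · have hw : w = x := by
          by_contra hw
          rw [List.count_append, List.count_singleton, if_neg (by simpa using hw)] at h
          exact hW h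
        subst hw
        refine ⟨W ++ [w], [], by simp, Or.inr ⟨h, ?_⟩⟩
        rw [List.count_append, List.count_singleton, if_neg (by simpa using hxy)]
        omega

/-- The history which ends with `V` and in which `x`, `y`, `z` have been requested `i`, `j`, `k`
times: before `V`, there is one run of requests to each of the three items. -/
def paddedHistory {n : ℕ} (x y z : Fin n) (i j k : ℕ) (V : List (Fin n)) : List (Fin n) :=
  List.replicate (k - V.count z) z ++ (List.replicate (j - V.count y) y ++
    (List.replicate (i - V.count x) x ++ V))

theorem paddedHistory_perm {n : ℕ} {x y z : Fin n} (hxy : x ≠ y) (hxz : x ≠ z) (hyz : y ≠ z)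
    {i j k : ℕ} {V : List (Fin n)} (hV : ∀ w ∈ V, w = x ∨ w = y ∨ w = z)
    (hi : V.length ≤ i) (hj : V.length ≤ j) (hk : V.length ≤ k) :
    (paddedHistory x y z i j k V).Perm (paddedHistory x y z i j k []) := by
  rw [List.perm_iff_count]
  intro w
  have hx := V.count_le_length (a := x)
  have hy := V.count_le_length (a := y)
  have hz := V.count_le_length (a := z)
  by_cases hw : w = x ∨ w = y ∨ w = z
  · rcases hw with rfl | rfl | rfl <;>
      simp [paddedHistory, List.count_replicate, hxy, hxz, hyz, hxy.symm, hxz.symm, hyz.symm] <;>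
      omega
  · have : V.count w = 0 := List.count_eq_zero.2 fun h => hw (hV w h)
    simp only [not_or] at hw
    simp [paddedHistory, List.count_replicate, this, Ne.symm hw.1, Ne.symm hw.2.1, Ne.symm hw.2.2]

/-- The numerical inequality behind the factor `8 / 5`: an optimal offline algorithm pays `4` for
every cycle and `1` for every alternation `x y`. -/
theorem eight_mul_le {fx fy T : ℕ} :
    8 * T - 1 ≤ T * ((fx + 1) + 1 + (if fy = 0 then fx + 1 else 0) + (fy + 1) + 1 +
      (if fx = 0 then fy + 1 else 0)) +
      ((if fy ≤ fx then T else 0) + (if fx ≤ fy then T - fx else 0)) := by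
  by_cases h : 4 ≤ fx + fy
  · have : T * 8 ≤ T * ((fx + 1) + 1 + (if fy = 0 then fx + 1 else 0) + (fy + 1) + 1 +
      (if fx = 0 then fy + 1 else 0)) := Nat.mul_le_mul_left _ (by omega)
    omega
  · have h1 : fx ≤ 3 := by omega
    have h2 : fy ≤ 3 := by omega
    interval_cases fx <;> interval_cases fy <;> simp <;> omega

/-- For any numbers `i`, `j`, `k` of previous requests, the requests of the hard tail cost a
projective algorithm at least `8 T - 1` in total if each of them has a history with just these
numbers of requests. -/
theorem le_sumAlong_hardTail {n : ℕ} {S : OnlineAlgorithm n} (hS : S.IsProjective) {x y z : Fin n}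
    (hxy : x ≠ y) (hxz : x ≠ z) (hyz : y ≠ z) {T i j k : ℕ}
    (hi : (hardTail x y z (8 * T) T).length ≤ i) (hj : (hardTail x y z (8 * T) T).length ≤ j)
    (hk : (hardTail x y z (8 * T) T).length ≤ k) :
    8 * T - 1 ≤ sumAlong (fun V w => (S (paddedHistory x y z i j k V) w : ℕ)) []
      (hardTail x y z (8 * T) T) := by
  let Adm : List (Fin n) → Prop := fun V =>
    V.length ≤ (hardTail x y z (8 * T) T).length ∧ ∀ w ∈ V, w = x ∨ w = y ∨ w = z
  have hadm : ∀ V l, Adm (V ++ l) → Adm V := fun V l h =>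
    ⟨by have := h.1; rw [List.length_append] at this; omega, fun w hw => h.2 w (by simp [hw])⟩
  have htail : Adm (hardTail x y z (8 * T) T) := by
    refine ⟨le_rfl, ?_⟩
    intro w
    simp only [hardTail, hardCycle, List.mem_append, List.mem_replicate, List.mem_flatten]
    rintro (h | h | h | h | h | ⟨l, ⟨-, rfl⟩, h⟩ | ⟨l, ⟨-, rfl⟩, h⟩)
    all_goals try simp only [List.mem_append, List.mem_replicate, List.mem_cons, List.not_mem_nil,
      or_false] at h
    all_goals tauto
  set P := 8 * T with hP
  set W₀ := paddedHistory x y z i j k [] with hW₀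
  set φ : List (Fin n) → Fin n → ℕ := fun V w => (S (paddedHistory x y z i j k V) w : ℕ) with hφ
  have hperm : ∀ V, Adm V → (paddedHistory x y z i j k V).Perm W₀ := fun V h =>
    paddedHistory_perm hxy hxz hyz h.2 (h.1.trans hi) (h.1.trans hj) (h.1.trans hk)
  have hbehind : ∀ {V} {u w : Fin n},
      S (paddedHistory x y z i j k V) u < S (paddedHistory x y z i j k V) w → 1 ≤ φ V w :=
    fun h => by
      rw [Fin.lt_def] at h
      simp only [hφ]
      omega
  have hlt_of_not : ∀ {V} {u w : Fin n}, u ≠ w → ¬ S V u < S V w → S V w < S V u :=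
    fun hne h => lt_of_le_of_ne (not_lt.1 h) fun he => hne ((S _).injective he).symm
  let V₁ := List.replicate P z
  let V₂ := V₁ ++ List.replicate P x
  let V₃ := V₂ ++ List.replicate P y
  let V₄ := V₃ ++ List.replicate P x
  let V₅ := V₄ ++ List.replicate (2 * P) y
  let V₆ := V₅ ++ (List.replicate T (hardCycle x y P)).flatten
  have hV₆ : hardTail x y z P T = V₆ ++ (List.replicate T [x, y]).flatten := by
    simp [hardTail, V₆, V₅, V₄, V₃, V₂, V₁]
  have A₆' : Adm (V₆ ++ (List.replicate T [x, y]).flatten) := hV₆ ▸ htail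
  have A₆ : Adm V₆ := hadm _ _ A₆'
  have A₅ : Adm V₅ := hadm _ _ A₆
  have A₄ : Adm V₄ := hadm _ _ A₅
  have A₃ : Adm V₃ := hadm _ _ A₄
  have A₂ : Adm V₂ := hadm _ _ A₃
  have A₁ : Adm V₁ := hadm _ _ A₂
  have hrun : ∀ (V : List (Fin n)) (w : Fin n) (r m : ℕ), r < m → Adm (V ++ List.replicate m w) →
      Adm (V ++ List.replicate r w) := by
    intro V w r m hr h
    apply hadm _ (List.replicate (m - r) w)
    rw [List.append_assoc, List.replicate_append_replicate]
    rwa [show r + (m - r) = m by omega]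
  have htot : sumAlong φ [] (hardTail x y z P T) =
      sumAlong φ [] (List.replicate P z) + sumAlong φ V₁ (List.replicate P x) +
      sumAlong φ V₂ (List.replicate P y) + sumAlong φ V₃ (List.replicate P x) +
      sumAlong φ V₄ (List.replicate (2 * P) y) +
      sumAlong φ V₅ (List.replicate T (hardCycle x y P)).flatten +
      sumAlong φ V₆ (List.replicate T [x, y]).flatten := by
    rw [hV₆]
    simp only [V₆, V₅, V₄, V₃, V₂, V₁, sumAlong_append, List.nil_append]
  rw [htot]
  have hcx₀ : W₀.count x = i := by
    simp [hW₀, paddedHistory, List.count_replicate, hxy.symm, hxz.symm]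
  have hcy₀ : W₀.count y = j := by
    simp [hW₀, paddedHistory, List.count_replicate, hxy, hyz.symm]
  have A₁' : Adm ([] ++ List.replicate P z) := A₁
  rcases exists_critical_requests hS hxy hxz hyz W₀ with h | h | ⟨a, b, ha, hb, v₁, v₂, h⟩
  · by_cases h0 : S W₀ x < S W₀ z
    · have := le_sumAlong_replicate (φ := φ) (w := z) (le_refl P) [] fun r hr =>
        hbehind ((h _ _ (hperm _ (hrun _ _ _ _ hr A₁')) (List.Perm.refl _)).2 h0)
      omega
    · have := le_sumAlong_replicate (φ := φ) (w := x) (le_refl P) V₁ fun r hr =>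
        hbehind (hlt_of_not hxz
          (mt (h _ _ (hperm _ (hrun _ _ _ _ hr A₂)) (List.Perm.refl _)).1 h0))
      omega
  · by_cases h0 : S W₀ y < S W₀ z
    · have := le_sumAlong_replicate (φ := φ) (w := z) (le_refl P) [] fun r hr =>
        hbehind ((h _ _ (hperm _ (hrun _ _ _ _ hr A₁')) (List.Perm.refl _)).2 h0)
      omega
    · have := le_sumAlong_replicate (φ := φ) (w := y) (le_refl P) V₂ fun r hr =>
        hbehind (hlt_of_not hyz
          (mt (h _ _ (hperm _ (hrun _ _ _ _ hr A₃)) (List.Perm.refl _)).1 h0))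
      omega
  rw [hcx₀] at ha
  rw [hcy₀] at hb
  -- `fx` and `fy` requests to `x` and `y` follow the critical ones.
  obtain ⟨fx, hfx⟩ : ∃ fx, fx = i - 1 - a := ⟨_, rfl⟩
  obtain ⟨fy, hfy⟩ : ∃ fy, fy = j - 1 - b := ⟨_, rfl⟩
  have hsplit : ∀ U₁ U₂, (U₁ ++ U₂).Perm W₀ → (fx < U₂.count x → U₂.count y ≤ fy →
      (S (U₁ ++ U₂) x < S (U₁ ++ U₂) y ↔ v₁)) ∧ (fy < U₂.count y → U₂.count x ≤ fx →
      (S (U₁ ++ U₂) x < S (U₁ ++ U₂) y ↔ v₂)) := by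
    intro U₁ U₂ hp
    have cx := hp.count_eq x
    have cy := hp.count_eq y
    rw [List.count_append, hcx₀] at cx
    rw [List.count_append, hcy₀] at cy
    exact ⟨fun h1 h2 => (h U₁ U₂ hp).1 (by omega) (by omega),
      fun h1 h2 => (h U₁ U₂ hp).2 (by omega) (by omega)⟩
  have hpad : ∀ U₁ U₂, paddedHistory x y z i j k (U₁ ++ U₂) =
      (List.replicate (k - (U₁ ++ U₂).count z) z ++ (List.replicate (j - (U₁ ++ U₂).count y) y ++
        (List.replicate (i - (U₁ ++ U₂).count x) x ++ U₁))) ++ U₂ := by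
    intro U₁ U₂
    simp [paddedHistory]
  have hL : ∀ U₁ U₂, Adm (U₁ ++ U₂) → fx < U₂.count x → U₂.count y ≤ fy →
      (S (paddedHistory x y z i j k (U₁ ++ U₂)) x < S (paddedHistory x y z i j k (U₁ ++ U₂)) y ↔
        v₁) := by
    intro U₁ U₂ hA h1 h2
    have := hperm _ hA
    rw [hpad] at this ⊢
    exact (hsplit _ U₂ this).1 h1 h2
  have hL' : ∀ U₁ U₂, Adm (U₁ ++ U₂) → fy < U₂.count y → U₂.count x ≤ fx →
      (S (paddedHistory x y z i j k (U₁ ++ U₂)) x < S (paddedHistory x y z i j k (U₁ ++ U₂)) y ↔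
        v₂) := by
    intro U₁ U₂ hA h1 h2
    have := hperm _ hA
    rw [hpad] at this ⊢
    exact (hsplit _ U₂ this).2 h1 h2
  have hfew : ∀ U, Adm U → U.count y ≤ fy →
      (S (paddedHistory x y z i j k U) x < S (paddedHistory x y z i j k U) y ↔ v₁) := by
    intro U hA h1
    have hp := hperm _ hA
    have hlen := U.count_le_length (a := x)
    have hlen' := hA.1
    have heq : paddedHistory x y z i j k U = (List.replicate (k - U.count z) z ++
        List.replicate (j - U.count y) y) ++ (List.replicate (i - U.count x) x ++ U) := by
      simp [paddedHistory]
    rw [heq] at hp ⊢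
    refine (hsplit _ _ hp).1 ?_ ?_
    · rw [List.count_append, List.count_replicate_self]
      omega
    · rw [List.count_append, List.count_replicate, if_neg (by simpa using hxy)]
      omega
  have hconst : ∀ U, Adm U → (v₁ ↔ v₂) →
      (S (paddedHistory x y z i j k U) x < S (paddedHistory x y z i j k U) y ↔ v₁) := by
    intro U hA h12
    have hp := hperm _ hA
    obtain ⟨U₁, U₂, hU, h'⟩ := exists_prefix_deciding hxy (b := b) (paddedHistory x y z i j k U)
      (show a < _ by rw [hp.count_eq, hcx₀]; exact ha)
    rw [hU] at hp ⊢
    rcases h' with h' | h'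
    · exact (h U₁ U₂ hp).1 h'.1 h'.2
    · exact ((h U₁ U₂ hp).2 h'.1 h'.2).trans h12.symm
  have hcz : ∀ (m : ℕ) (w : Fin n), w ≠ z → (List.replicate m z).count w = 0 := fun m w hw => by
    rw [List.count_replicate, if_neg (by simpa using hw.symm)]
  have hcx : ∀ m, (List.replicate m x).count x = m := fun m => List.count_replicate_self
  have hcy : ∀ m, (List.replicate m y).count y = m := fun m => List.count_replicate_self
  have hcxy : ∀ m, (List.replicate m x).count y = 0 := fun m => by
    rw [List.count_replicate]; simp [hxy]
  have hcyx : ∀ m, (List.replicate m y).count x = 0 := fun m => by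
    rw [List.count_replicate]; simp [hxy.symm]
  by_cases hv₁ : v₁
  · by_cases hv₂ : v₂
    · have := le_sumAlong_replicate (φ := φ) (w := y) (le_refl P) V₂ fun r hr =>
        hbehind ((hconst _ (hrun _ _ _ _ hr A₃) (by tauto)).2 hv₁)
      omega
    · by_cases hfyP : P ≤ fy
      · have := le_sumAlong_replicate (φ := φ) (w := y) (le_refl P) V₂ fun r hr =>
          hbehind ((hfew _ (hrun _ _ _ _ hr A₃) (by
            simp only [V₂, V₁, List.count_append, hcz _ y hyz, hcxy, hcy]
            omega)).2 hv₁)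
        omega
      · by_cases hfxP : P ≤ fx
        · have := le_sumAlong_replicate (φ := φ) (w := x) (le_refl P) V₃ fun r hr => by
            have hA := hrun _ _ _ _ hr A₄
            refine hbehind (u := y) (hlt_of_not hxy ?_)
            have heq : V₃ ++ List.replicate r x = V₂ ++ (List.replicate P y ++ List.replicate r x) := by
              simp [V₃]
            rw [heq] at hA ⊢
            refine mt (hL' _ _ hA ?_ ?_).1 hv₂
            · rw [List.count_append, hcy]
              omega
            · rw [List.count_append, hcyx, hcx]
              omega
          omega
        · -- The algorithm looks at the last `P` requests to `x` and to `y` only.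
          have hy : ∀ U₁ U₂, Adm (U₁ ++ U₂) → fx < U₂.count x → U₂.count y ≤ fy →
              1 ≤ φ (U₁ ++ U₂) y := fun U₁ U₂ hA h1 h2 => hbehind ((hL U₁ U₂ hA h1 h2).2 hv₁)
          have hx : ∀ U₁ U₂, Adm (U₁ ++ U₂) → fy < U₂.count y → U₂.count x ≤ fx →
              1 ≤ φ (U₁ ++ U₂) x := fun U₁ U₂ hA h1 h2 =>
            hbehind (hlt_of_not hxy (mt (hL' U₁ U₂ hA h1 h2).1 hv₂))
          have hV₅ : V₅ = (V₄ ++ List.replicate P y) ++ List.replicate P y := by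
            rw [List.append_assoc V₄, List.replicate_append_replicate, ← two_mul]
          have c₁ := le_sumAlong_hardCycles hxy hadm hy hx (by omega : fx < P)
            (by omega : fy < P) T (V₄ ++ List.replicate P y) (by rw [← hV₅]; exact A₆)
          obtain ⟨c₁, V', hV'⟩ := c₁
          rw [← hV₅] at c₁ hV'
          have c₂ := le_sumAlong_alternating hxy hadm hy hx (by omega : fy < P) V' T
            (hV' ▸ A₆')
          rw [← hV'] at c₂
          have := eight_mul_le (fx := fx) (fy := fy) (T := T)
          simp only [V₆]
          omega
  · by_cases hv₂ : v₂
    · by_cases hfyP : P ≤ fy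
      · have := le_sumAlong_replicate (φ := φ) (w := x) (le_refl P) V₃ fun r hr =>
          hbehind (hlt_of_not hxy (mt (hfew _ (hrun _ _ _ _ hr A₄) (by
            simp only [V₃, V₂, V₁, List.count_append, hcz _ y hyz, hcxy, hcy]
            omega)).1 hv₁))
        omega
      · have := sub_le_sumAlong_replicate (φ := φ) (w := y) (f := fy + 1) (m := 2 * P) V₄
          fun r hr hr' => hbehind ((hL' _ _ (hrun _ _ _ _ hr' A₅) (by
            rw [hcy]
            omega) (by
            rw [hcyx]
            omega)).2 hv₂)
        omega
    · have := le_sumAlong_replicate (φ := φ) (w := x) (le_refl P) V₁ fun r hr =>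
        hbehind (hlt_of_not hxy (mt (hconst _ (hrun _ _ _ _ hr A₂) (by tauto)).1 hv₁))
      omega

/-! ### Averaging over the numbers of initial requests -/

theorem sum_Ico_sub_le (f : ℕ → ℕ) {c D : ℕ} (hc : c ≤ D) (N : ℕ) :
    ∑ i ∈ Finset.Ico D N, f (i - c) ≤ ∑ a ∈ Finset.range N, f a := by
  rw [← Finset.sum_image (f := f) (g := fun i => i - c)]
  · apply Finset.sum_le_sum_of_subset
    intro a
    simp only [Finset.mem_image, Finset.mem_Ico, Finset.mem_range]
    rintro ⟨i, hi, rfl⟩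
    omega
  · intro i hi j hj hij
    simp only [Finset.coe_Ico, Set.mem_Ico] at hi hj hij
    omega

/-- Double counting: summed over the numbers of initial requests, the cost of the requests `l` is at
least the sum, over the numbers `i`, `j`, `k` of requests in the histories of the single requests, of
the costs of the requests with these histories. -/
theorem sum_sumAlong_paddedHistory_le {n : ℕ} {x y z : Fin n} (φ : List (Fin n) → Fin n → ℕ)
    {D : ℕ} (N : ℕ) (l : List (Fin n)) : ∀ V : List (Fin n), V.length + l.length ≤ D →
    ∑ k ∈ Finset.Ico D N, ∑ j ∈ Finset.Ico D N, ∑ i ∈ Finset.Ico D N,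
      sumAlong (fun V w => φ (paddedHistory x y z i j k V) w) V l ≤
    ∑ k ∈ Finset.range N, ∑ j ∈ Finset.range N, ∑ i ∈ Finset.range N,
      sumAlong φ (List.replicate k z ++ (List.replicate j y ++ (List.replicate i x ++ V))) l := by
  induction l with
  | nil => intro V _; simp [sumAlong]
  | cons w l ih =>
    intro V hV
    rw [List.length_cons] at hV
    have h1 := ih (V ++ [w]) (by rw [List.length_append, List.length_singleton]; omega)
    simp only [sumAlong, Finset.sum_add_distrib]
    refine Nat.add_le_add ?_ (by simpa using h1)
    have hx := V.count_le_length (a := x)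
    have hy := V.count_le_length (a := y)
    have hz := V.count_le_length (a := z)
    simp only [paddedHistory]
    calc _ ≤ ∑ k ∈ Finset.Ico D N, ∑ j ∈ Finset.Ico D N, ∑ i ∈ Finset.range N,
          φ (List.replicate (k - V.count z) z ++ (List.replicate (j - V.count y) y ++
            (List.replicate i x ++ V))) w :=
          Finset.sum_le_sum fun k _ => Finset.sum_le_sum fun j _ =>
            sum_Ico_sub_le (fun i => φ (List.replicate (k - V.count z) z ++
              (List.replicate (j - V.count y) y ++ (List.replicate i x ++ V))) w) (by omega) N
      _ ≤ ∑ k ∈ Finset.Ico D N, ∑ j ∈ Finset.range N, ∑ i ∈ Finset.range N,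
          φ (List.replicate (k - V.count z) z ++ (List.replicate j y ++
            (List.replicate i x ++ V))) w :=
          Finset.sum_le_sum fun k _ =>
            sum_Ico_sub_le (fun j => ∑ i ∈ Finset.range N, φ (List.replicate (k - V.count z) z ++
              (List.replicate j y ++ (List.replicate i x ++ V))) w) (by omega) N
      _ ≤ _ :=
            sum_Ico_sub_le (fun k => ∑ j ∈ Finset.range N, ∑ i ∈ Finset.range N,
              φ (List.replicate k z ++ (List.replicate j y ++ (List.replicate i x ++ V))) w)
              (by omega) N

theorem sum_fin_eq_sumAlong {ι : Type*} (φ : List ι → ι → ℕ) (σ : List ι) : ∀ V : List ι,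
    ∑ k : Fin σ.length, φ (V ++ σ.take k) (σ.get k) = sumAlong φ V σ := by
  induction σ with
  | nil => intro V; simp [sumAlong]
  | cons w l ih =>
    intro V
    rw [sumAlong, ← ih (V ++ [w])]
    simp [Fin.sum_univ_succ]

theorem sumAlong_le_cost {n : ℕ} (S : OnlineAlgorithm n) (σ : List (Fin n)) :
    sumAlong (fun V w => (S V w : ℕ)) [] σ ≤ S.cost σ := by
  rw [← sum_fin_eq_sumAlong]
  exact Finset.sum_le_sum fun k _ => position_le_rearrangeCost_add_accessCost _ _ _

/-- The hard request sequences, with varying numbers `i`, `j`, `k` of initial requests. -/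
def hardSequence {n : ℕ} (x y z : Fin n) (T i j k : ℕ) : List (Fin n) :=
  List.replicate k z ++ (List.replicate j y ++ (List.replicate i x ++ hardTail x y z (8 * T) T))

theorem le_sum_cost_hardSequence {n : ℕ} {S : OnlineAlgorithm n} (hS : S.IsProjective)
    {x y z : Fin n} (hxy : x ≠ y) (hxz : x ≠ z) (hyz : y ≠ z) (T N : ℕ) :
    (N - (hardTail x y z (8 * T) T).length) ^ 3 * (8 * T - 1) ≤
      ∑ k ∈ Finset.range N, ∑ j ∈ Finset.range N, ∑ i ∈ Finset.range N,
        S.cost (hardSequence x y z T i j k) := by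
  set D := (hardTail x y z (8 * T) T).length with hD
  calc (N - D) ^ 3 * (8 * T - 1) = ∑ k ∈ Finset.Ico D N, ∑ j ∈ Finset.Ico D N,
        ∑ i ∈ Finset.Ico D N, (8 * T - 1) := by
        simp only [Finset.sum_const, Nat.card_Ico, smul_eq_mul]
        ring
    _ ≤ ∑ k ∈ Finset.Ico D N, ∑ j ∈ Finset.Ico D N, ∑ i ∈ Finset.Ico D N,
        sumAlong (fun V w => (S (paddedHistory x y z i j k V) w : ℕ)) []
          (hardTail x y z (8 * T) T) :=
        Finset.sum_le_sum fun k hk => Finset.sum_le_sum fun j hj => Finset.sum_le_sum fun i hi =>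
          le_sumAlong_hardTail hS hxy hxz hyz (Finset.mem_Ico.1 hi).1 (Finset.mem_Ico.1 hj).1
            (Finset.mem_Ico.1 hk).1
    _ ≤ _ := sum_sumAlong_paddedHistory_le (fun V w => (S V w : ℕ)) N _ [] (by simp [hD])
    _ ≤ _ := by
        refine Finset.sum_le_sum fun k hk => Finset.sum_le_sum fun j hj =>
          Finset.sum_le_sum fun i hi => ?_
        refine le_trans ?_ (sumAlong_le_cost S _)
        have hsplit : hardSequence x y z T i j k = (List.replicate k z ++ (List.replicate j y ++
            (List.replicate i x ++ []))) ++ hardTail x y z (8 * T) T := by simp [hardSequence]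
        rw [hsplit, sumAlong_append]
        exact Nat.le_add_left _ _

/-! ### The optimum offline cost of the hard request sequences -/

theorem exists_serveCost_eq_OPT {n : ℕ} (s : ListState n) (σ : List (Fin n)) :
    ∃ T : ℕ → ListState n, T 0 = s ∧ serveCost T σ = OPT s σ :=
  Nat.sInf_mem (s := {k | ∃ T : ℕ → ListState n, T 0 = s ∧ serveCost T σ = k})
    ⟨_, fun _ => s, rfl, rfl⟩

theorem OPT_le_serveCost {n : ℕ} (T : ℕ → ListState n) (σ : List (Fin n)) :
    OPT (T 0) σ ≤ serveCost T σ :=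
  Nat.sInf_le ⟨T, rfl, rfl⟩

theorem serveCost_cons {n : ℕ} (T : ℕ → ListState n) (w : Fin n) (σ : List (Fin n)) :
    serveCost T (w :: σ) = rearrangeCost (T 0) (T 1) + accessCost (T 1) w +
      serveCost (fun k => T (k + 1)) σ := by
  rw [serveCost]
  exact Fin.sum_univ_succ (n := σ.length) _

theorem OPT_nil {n : ℕ} (s : ListState n) : OPT s [] = 0 := by
  have := OPT_le_serveCost (fun _ => s) []
  simpa [serveCost] using this

theorem rearrangeCost_self {n : ℕ} (s : ListState n) : rearrangeCost s s = 0 :=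
  SimpleGraph.dist_self

theorem rearrangeCost_triangle {n : ℕ} (s t u : ListState n) :
    rearrangeCost s u ≤ rearrangeCost s t + rearrangeCost t u := by
  simp only [rearrangeCost_eq_card_inversions]
  refine le_trans (Finset.card_le_card ?_) (Finset.card_union_le _ _)
  rintro ⟨a, b⟩ h
  obtain ⟨h1, h2⟩ := mem_inversions.1 h
  rw [Finset.mem_union, mem_inversions, mem_inversions]
  rcases lt_trichotomy (t a) (t b) with h3 | h3 | h3
  · exact Or.inr ⟨h3, h2⟩
  · rw [t.injective h3] at h1
    exact absurd h1 (lt_irrefl _)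
  · exact Or.inl ⟨h1, h3⟩

theorem OPT_cons_le {n : ℕ} (s : ListState n) (w : Fin n) (σ : List (Fin n)) :
    OPT s (w :: σ) ≤ s w + OPT s σ := by
  obtain ⟨T, hT, hc⟩ := exists_serveCost_eq_OPT s σ
  have := OPT_le_serveCost (fun k => if k = 0 then s else T (k - 1)) (w :: σ)
  rw [serveCost_cons] at this
  simp only [if_true, Nat.add_eq_zero_iff, one_ne_zero, and_false, if_false, Nat.add_sub_cancel,
    Nat.sub_self, hT, rearrangeCost_self, zero_add, hc] at this
  exact this

theorem OPT_le_rearrangeCost_add {n : ℕ} (s t : ListState n) (σ : List (Fin n)) :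
    OPT s σ ≤ rearrangeCost s t + OPT t σ := by
  cases σ with
  | nil => simp [OPT_nil]
  | cons w σ =>
    obtain ⟨T, hT, hc⟩ := exists_serveCost_eq_OPT t (w :: σ)
    rw [← hc]
    have := OPT_le_serveCost (fun k => if k = 0 then s else T k) (w :: σ)
    rw [serveCost_cons] at this ⊢
    simp only [if_true, Nat.add_eq_zero_iff, one_ne_zero, and_false, if_false] at this
    have h2 := rearrangeCost_triangle s t (T 1)
    rw [hT]
    omega

theorem OPT_replicate_append_le {n : ℕ} {s : ListState n} {w : Fin n} (h : (s w : ℕ) = 0) (m : ℕ)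
    (σ : List (Fin n)) : OPT s (List.replicate m w ++ σ) ≤ OPT s σ := by
  induction m with
  | zero => simp
  | succ m ih =>
    rw [List.replicate_succ, List.cons_append]
    have := OPT_cons_le s w (List.replicate m w ++ σ)
    omega

theorem rearrangeCost_le {n : ℕ} (s t : ListState n) : rearrangeCost s t ≤ n * n := by
  rw [rearrangeCost_eq_card_inversions]
  simpa using Finset.card_le_univ (inversions s t)

/-- Offline, each cycle costs `4` (two exchanges and two accesses in the second position), each
alternation costs `1`, and each of the eight initial runs at most one rearrangement. -/
theorem OPT_hardSequence_le {n : ℕ} (L₀ : ListState n) {x y z : Fin n} (hx : (x : ℕ) = 0)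
    (hy : (y : ℕ) = 1) (T i j k : ℕ) :
    OPT L₀ (hardSequence x y z T i j k) ≤ 5 * T + 8 * (n * n) := by
  set X : ListState n := Equiv.refl _ with hX
  set Y : ListState n := Equiv.swap x y with hY
  set Z : ListState n := Equiv.swap x z with hZ
  have hXx : (X x : ℕ) = 0 := by simp [hX, hx]
  have hXy : (X y : ℕ) = 1 := by simp [hX, hy]
  have hYy : (Y y : ℕ) = 0 := by simp [hY, hx]
  have hYx : (Y x : ℕ) = 1 := by simp [hY, hy]
  have hZz : (Z z : ℕ) = 0 := by simp [hZ, hx]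
  have hadj : (exchangeGraph n).Adj X Y := by
    rw [exchangeGraph, SimpleGraph.fromRel_adj]
    refine ⟨fun he => ?_, Or.inl ⟨x, y, by omega, rfl⟩⟩
    rw [he] at hXx
    omega
  have hXY : rearrangeCost X Y ≤ 1 := (SimpleGraph.dist_eq_one_iff_adj.2 hadj).le
  have hYX : rearrangeCost Y X ≤ 1 := (SimpleGraph.dist_eq_one_iff_adj.2 hadj.symm).le
  have halt : ∀ t, OPT Y (List.replicate t [x, y]).flatten ≤ t := by
    intro t
    induction t with
    | zero => simp [OPT_nil]
    | succ t ih =>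
      rw [List.replicate_succ, List.flatten_cons, List.cons_append, List.cons_append,
        List.nil_append]
      have h1 := OPT_cons_le Y x (y :: (List.replicate t [x, y]).flatten)
      have h2 := OPT_cons_le Y y (List.replicate t [x, y]).flatten
      omega
  have hcycle : ∀ (P : ℕ) (σ : List (Fin n)), OPT Y (hardCycle x y P ++ σ) ≤ 4 + OPT Y σ := by
    intro P σ
    simp only [hardCycle, List.append_assoc, List.cons_append, List.nil_append]
    refine (OPT_le_rearrangeCost_add Y X _).trans ?_
    have h1 := OPT_replicate_append_le hXx P
      (y :: (List.replicate P x ++ (List.replicate P y ++ x :: (List.replicate P y ++ σ))))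
    have h2 := OPT_cons_le X y
      (List.replicate P x ++ (List.replicate P y ++ x :: (List.replicate P y ++ σ)))
    have h3 := OPT_replicate_append_le hXx P
      (List.replicate P y ++ x :: (List.replicate P y ++ σ))
    have h4 := OPT_le_rearrangeCost_add X Y
      (List.replicate P y ++ x :: (List.replicate P y ++ σ))
    have h5 := OPT_replicate_append_le hYy P (x :: (List.replicate P y ++ σ))
    have h6 := OPT_cons_le Y x (List.replicate P y ++ σ)
    have h7 := OPT_replicate_append_le hYy P σ
    omega
  have hcycles : ∀ (P t : ℕ) (σ : List (Fin n)),
      OPT Y ((List.replicate t (hardCycle x y P)).flatten ++ σ) ≤ 4 * t + OPT Y σ := by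
    intro P t σ
    induction t with
    | zero => simp
    | succ t ih =>
      rw [List.replicate_succ, List.flatten_cons, List.append_assoc]
      have := hcycle P ((List.replicate t (hardCycle x y P)).flatten ++ σ)
      omega
  have hrun : ∀ (s t : ListState n) (w : Fin n) (m : ℕ) (σ : List (Fin n)), (t w : ℕ) = 0 →
      OPT s (List.replicate m w ++ σ) ≤ n * n + OPT t σ := by
    intro s t w m σ h
    exact (OPT_le_rearrangeCost_add s t _).trans
      (Nat.add_le_add (rearrangeCost_le s t) (OPT_replicate_append_le h m σ))
  rw [hardSequence, hardTail]
  refine (hrun L₀ Z z k _ hZz).trans ?_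
  have h1 := halt T
  have h2 := hcycles (8 * T) T (List.replicate T [x, y]).flatten
  refine le_trans (Nat.add_le_add_left (hrun Z Y y j _ hYy) _) ?_
  refine le_trans (Nat.add_le_add_left (Nat.add_le_add_left (hrun Y X x i _ hXx) _) _) ?_
  have e3 := hrun X Z z (8 * T) (List.replicate (8 * T) x ++ (List.replicate (8 * T) y ++
    (List.replicate (8 * T) x ++ (List.replicate (2 * (8 * T)) y ++
    ((List.replicate T (hardCycle x y (8 * T))).flatten ++ (List.replicate T [x, y]).flatten))))) hZz
  have e4 := hrun Z X x (8 * T) (List.replicate (8 * T) y ++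
    (List.replicate (8 * T) x ++ (List.replicate (2 * (8 * T)) y ++
    ((List.replicate T (hardCycle x y (8 * T))).flatten ++ (List.replicate T [x, y]).flatten)))) hXx
  have e5 := hrun X Y y (8 * T)
    (List.replicate (8 * T) x ++ (List.replicate (2 * (8 * T)) y ++
    ((List.replicate T (hardCycle x y (8 * T))).flatten ++ (List.replicate T [x, y]).flatten))) hYy
  have e6 := hrun Y X x (8 * T) (List.replicate (2 * (8 * T)) y ++
    ((List.replicate T (hardCycle x y (8 * T))).flatten ++ (List.replicate T [x, y]).flatten)) hXx
  have e7 := hrun X Y y (2 * (8 * T))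
    ((List.replicate T (hardCycle x y (8 * T))).flatten ++ (List.replicate T [x, y]).flatten) hYy
  omega

/-! ### Expected costs -/

theorem measurable_cost {n : ℕ} (σ : List (Fin n)) :
    Measurable fun S : OnlineAlgorithm n => (S.cost σ : ℝ) := by
  have h : Measurable fun S : OnlineAlgorithm n => S.cost σ := by
    unfold OnlineAlgorithm.cost serveCost
    refine Finset.measurable_sum _ fun k _ => ?_
    have hp : Measurable fun S : OnlineAlgorithm n => (S (σ.take k), S (σ.take (k + 1))) :=
      (measurable_pi_apply (X := fun _ : List (Fin n) => ListState n) _).prodMk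
        (measurable_pi_apply (X := fun _ : List (Fin n) => ListState n) _)
    exact (measurable_from_prod_countable_right (f := fun p : ListState n × ListState n =>
      rearrangeCost p.1 p.2 + accessCost p.2 (σ.get k)) fun _ => measurable_from_top).comp hp
  exact measurable_from_top.comp h

theorem integrable_cost {n : ℕ} (μ : Measure (OnlineAlgorithm n)) [IsFiniteMeasure μ]
    (σ : List (Fin n)) : Integrable (fun S : OnlineAlgorithm n => (S.cost σ : ℝ)) μ := by
  refine Integrable.of_bound (measurable_cost σ).aestronglyMeasurable
    ((σ.length * (n * n + n) : ℕ) : ℝ) (Filter.Eventually.of_forall fun S => ?_)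
  rw [Real.norm_natCast, Nat.cast_le, OnlineAlgorithm.cost, serveCost]
  refine (Finset.sum_le_card_nsmul _ _ (n * n + n) fun k _ => ?_).trans (by simp)
  exact Nat.add_le_add (rearrangeCost_le _ _) (Fin.is_lt _).le

/-- The boundary terms of the double counting are negligible for large `N`. -/
theorem le_of_forall_sub_pow_mul_le {D : ℕ} {u K : ℝ}
    (h : ∀ N : ℕ, D ≤ N → ((N : ℝ) - D) ^ 3 * u ≤ (N : ℝ) ^ 3 * K) : u ≤ K := by
  have hlim : Filter.Tendsto (fun N : ℕ => (1 - (D : ℝ) / N) ^ 3 * u) Filter.atTop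
      (nhds ((1 - 0) ^ 3 * u)) :=
    ((tendsto_const_nhds.sub (tendsto_const_div_atTop_nhds_zero_nat (D : ℝ))).pow 3).mul_const u
  rw [sub_zero, one_pow, one_mul] at hlim
  refine le_of_tendsto hlim ?_
  filter_upwards [Filter.eventually_ge_atTop (D + 1)] with N hN
  have hpos : (0 : ℝ) < N := by exact_mod_cast (by omega : 0 < N)
  have := h N (by omega)
  have heq : (1 - (D : ℝ) / N) ^ 3 * u = (((N : ℝ) - D) ^ 3 * u) / (N : ℝ) ^ 3 := by
    field_simp
  rw [heq, div_le_iff₀ (by positivity)]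
  linarith

theorem eight_fifths_le_of_isCompetitiveWith {n : ℕ} (hn : 3 ≤ n) {L₀ : ListState n}
    {A : RandomizedAlgorithm L₀} (hA : A.IsProjective) {c b : ℝ} (hc : A.IsCompetitiveWith c b) :
    8 / 5 ≤ c := by
  have := A.isProbabilityMeasure
  by_contra! hlt
  set x : Fin n := ⟨0, by omega⟩ with hx
  set y : Fin n := ⟨1, by omega⟩ with hy
  set z : Fin n := ⟨2, by omega⟩ with hz
  have hxy : x ≠ y := by simp [hx, hy]
  have hxz : x ≠ z := by simp [hx, hz]
  have hyz : y ≠ z := by simp [hy, hz]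
  have hc' : max c 0 < 8 / 5 := max_lt hlt (by norm_num)
  have key : ∀ T : ℕ, 8 * (T : ℝ) - 1 ≤ max c 0 * (5 * T + 8 * (n * n)) + b := by
    intro T
    refine le_of_forall_sub_pow_mul_le (D := (hardTail x y z (8 * T) T).length) fun N hN => ?_
    set D := (hardTail x y z (8 * T) T).length with hD
    have h1 : ∀ i j k, A.expectedCost (hardSequence x y z T i j k) ≤
        max c 0 * (5 * T + 8 * (n * n)) + b := by
      intro i j k
      have h2 := OPT_hardSequence_le L₀ (x := x) (y := y) (z := z) rfl rfl T i j k
      have h3 : (OPT L₀ (hardSequence x y z T i j k) : ℝ) ≤ 5 * T + 8 * (n * n) := by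
        exact_mod_cast h2
      have h4 : c * (OPT L₀ (hardSequence x y z T i j k) : ℝ) ≤
          max c 0 * (OPT L₀ (hardSequence x y z T i j k) : ℝ) :=
        mul_le_mul_of_nonneg_right (le_max_left _ _) (Nat.cast_nonneg _)
      have h5 : max c 0 * (OPT L₀ (hardSequence x y z T i j k) : ℝ) ≤
          max c 0 * (5 * T + 8 * (n * n)) := mul_le_mul_of_nonneg_left h3 (le_max_right _ _)
      have := hc (hardSequence x y z T i j k)
      linarith
    calc ((N : ℝ) - D) ^ 3 * (8 * T - 1)
        = ∫ _, ((N : ℝ) - D) ^ 3 * (8 * T - 1) ∂A.law := by simp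
      _ ≤ ∫ S, ∑ k ∈ Finset.range N, ∑ j ∈ Finset.range N, ∑ i ∈ Finset.range N,
          (OnlineAlgorithm.cost S (hardSequence x y z T i j k) : ℝ) ∂A.law := by
          refine integral_mono_ae (integrable_const _) (integrable_finsetSum _ fun k _ =>
            integrable_finsetSum _ fun j _ => integrable_finsetSum _ fun i _ =>
            integrable_cost _ _) ?_
          filter_upwards [hA] with S hS
          have h2 := le_sum_cost_hardSequence hS hxy hxz hyz T N
          rw [← hD] at h2
          have h3 : (((N - D) ^ 3 * (8 * T - 1) : ℕ) : ℝ) ≤ ∑ k ∈ Finset.range N,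
              ∑ j ∈ Finset.range N, ∑ i ∈ Finset.range N,
              (OnlineAlgorithm.cost S (hardSequence x y z T i j k) : ℝ) := by
            exact_mod_cast h2
          refine le_trans ?_ h3
          rw [Nat.cast_mul, Nat.cast_pow, Nat.cast_sub hN]
          refine mul_le_mul_of_nonneg_left ?_ (pow_nonneg (sub_nonneg.2 (Nat.cast_le.2 hN)) 3)
          have h4 : ((8 * T : ℕ) : ℝ) ≤ ((8 * T - 1 : ℕ) : ℝ) + 1 := by
            exact_mod_cast (by omega : 8 * T ≤ (8 * T - 1) + 1)
          push_cast at h4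
          linarith
      _ = ∑ k ∈ Finset.range N, ∑ j ∈ Finset.range N, ∑ i ∈ Finset.range N,
          A.expectedCost (hardSequence x y z T i j k) := by
          rw [integral_finsetSum _ fun k _ => integrable_finsetSum _ fun j _ =>
            integrable_finsetSum _ fun i _ => integrable_cost _ _]
          refine Finset.sum_congr rfl fun k _ => ?_
          rw [integral_finsetSum _ fun j _ => integrable_finsetSum _ fun i _ => integrable_cost _ _]
          refine Finset.sum_congr rfl fun j _ => ?_
          rw [integral_finsetSum _ fun i _ => integrable_cost _ _]
          rfl
      _ ≤ ∑ k ∈ Finset.range N, ∑ j ∈ Finset.range N, ∑ i ∈ Finset.range N,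
          (max c 0 * (5 * T + 8 * (n * n)) + b) :=
          Finset.sum_le_sum fun k _ => Finset.sum_le_sum fun j _ => Finset.sum_le_sum fun i _ =>
            h1 i j k
      _ = (N : ℝ) ^ 3 * (max c 0 * (5 * T + 8 * (n * n)) + b) := by
          simp only [Finset.sum_const, Finset.card_range, nsmul_eq_mul]
          ring
  obtain ⟨T, hT⟩ := exists_nat_gt ((max c 0 * (8 * (n * n)) + b + 1) / (8 - 5 * max c 0))
  rw [div_lt_iff₀ (by linarith)] at hT
  have := key T
  nlinarith

/-! ### Critical request algorithms -/

theorem exists_count_take_eq {n : ℕ} {x : Fin n} {q : ℕ} (σ : List (Fin n)) (hq : q ≤ σ.count x) :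
    ∃ k ≤ σ.length, (σ.take k).count x = q := by
  induction σ using List.reverseRecOn with
  | nil => exact ⟨0, le_rfl, by simpa [eq_comm] using hq⟩
  | append_singleton σ w ih =>
    by_cases h : q ≤ σ.count x
    · obtain ⟨k, hk, hc⟩ := ih h
      exact ⟨k, by rw [List.length_append]; omega, by rwa [List.take_append_of_le_length hk]⟩
    · refine ⟨(σ ++ [w]).length, le_rfl, ?_⟩
      rw [List.take_length]
      have h1 : (σ ++ [w]).count x ≤ σ.count x + 1 := by
        rw [List.count_append]
        exact Nat.add_le_add_left (List.count_le_length (l := [w])) _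
      omega

theorem requestTime_zero {n : ℕ} (σ : List (Fin n)) (x : Fin n) : requestTime σ x 0 = 0 :=
  Nat.le_zero.1 (Nat.sInf_le (by simp))

theorem count_take_requestTime {n : ℕ} {σ : List (Fin n)} {x : Fin n} {q : ℕ}
    (hq : q ≤ σ.count x) : (σ.take (requestTime σ x q)).count x = q := by
  obtain ⟨k, -, hk⟩ := exists_count_take_eq σ hq
  exact Nat.sInf_mem (s := {k | (σ.take k).count x = q}) ⟨k, hk⟩

theorem requestTime_le_length {n : ℕ} {σ : List (Fin n)} {x : Fin n} {q : ℕ}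
    (hq : q ≤ σ.count x) : requestTime σ x q ≤ σ.length := by
  obtain ⟨k, hk, hc⟩ := exists_count_take_eq σ hq
  exact (Nat.sInf_le (s := {k | (σ.take k).count x = q}) hc).trans hk

theorem requestTime_append_singleton {n : ℕ} {σ : List (Fin n)} {x : Fin n} {q : ℕ}
    (hq : q ≤ σ.count x) (w : Fin n) : requestTime (σ ++ [w]) x q = requestTime σ x q := by
  have h1 : requestTime (σ ++ [w]) x q ≤ requestTime σ x q := by
    refine Nat.sInf_le ?_
    rw [Set.mem_ofPred_eq, List.take_append_of_le_length (requestTime_le_length hq)]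
    exact count_take_requestTime hq
  refine le_antisymm h1 (Nat.sInf_le ?_)
  have h2 := count_take_requestTime (σ := σ ++ [w]) (x := x) (q := q) (by
    rw [List.count_append]
    omega)
  rwa [List.take_append_of_le_length (h1.trans (requestTime_le_length hq))] at h2

theorem requestTime_append_self {n : ℕ} (σ : List (Fin n)) (x : Fin n) :
    requestTime (σ ++ [x]) x (σ.count x + 1) = σ.length + 1 := by
  have hc : (σ ++ [x]).count x = σ.count x + 1 := by simp
  have h1 := requestTime_le_length (σ := σ ++ [x]) (x := x) hc.ge
  have h2 := count_take_requestTime (σ := σ ++ [x]) (x := x) hc.ge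
  rw [List.length_append, List.length_singleton] at h1
  by_contra hne
  rw [List.take_append_of_le_length (by omega)] at h2
  have := (List.take_sublist (requestTime (σ ++ [x]) x (σ.count x + 1)) σ).count_le x
  omega

/-- The relative order of the requests to two items is not changed by the projection. -/
theorem requestTime_lt_iff_proj {n : ℕ} {x y u v : Fin n} (hu : u = x ∨ u = y) (hv : v = x ∨ v = y)
    (σ : List (Fin n)) : ∀ q r : ℕ, q ≤ σ.count u → r ≤ σ.count v →
      (requestTime σ u q < requestTime σ v r ↔
        requestTime (proj x y σ) u q < requestTime (proj x y σ) v r) := by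
  have hcount : ∀ u, u = x ∨ u = y → ∀ σ : List (Fin n), (proj x y σ).count u = σ.count u := by
    intro u hu σ
    rw [proj, List.count_filter (by simpa using hu)]
  induction σ using List.reverseRecOn with
  | nil => intro q r _ _; rfl
  | append_singleton σ w ih =>
    intro q r hq hr
    have hcases : ∀ u q, q ≤ (σ ++ [w]).count u → q ≤ σ.count u ∨ (u = w ∧ q = σ.count u + 1) := by
      intro u q hq
      by_cases hw : w = u
      · subst hw
        rw [List.count_append, List.count_singleton_self] at hq
        omega
      · rw [List.count_append, List.count_singleton, if_neg (by simpa using hw)] at hq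
        omega
    by_cases hw : w = x ∨ w = y
    · have hproj : proj x y (σ ++ [w]) = proj x y σ ++ [w] := by
        rw [proj_append, proj_cons_of_mem hw]
        rfl
      rw [hproj]
      have hnew : requestTime (proj x y σ ++ [w]) w (σ.count w + 1) = (proj x y σ).length + 1 := by
        rw [← hcount w hw, requestTime_append_self]
      rcases hcases u q hq with h1 | ⟨rfl, rfl⟩ <;> rcases hcases v r hr with h2 | ⟨h2, h2'⟩
      · rw [requestTime_append_singleton h1, requestTime_append_singleton h2,
          requestTime_append_singleton (by rwa [hcount u hu]),
          requestTime_append_singleton (by rwa [hcount v hv])]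
        exact ih q r h1 h2
      · subst h2 h2'
        rw [requestTime_append_singleton h1, requestTime_append_self, hnew,
          requestTime_append_singleton (by rwa [hcount u hu])]
        have e1 := requestTime_le_length h1
        have e2 := requestTime_le_length (σ := proj x y σ) (x := u) (q := q) (by rwa [hcount u hu])
        omega
      · rw [requestTime_append_singleton h2, requestTime_append_self, hnew,
          requestTime_append_singleton (by rwa [hcount v hv])]
        have e1 := requestTime_le_length h2
        have e2 := requestTime_le_length (σ := proj x y σ) (x := v) (q := r) (by rwa [hcount v hv])
        omega
      · subst h2 h2'
        simp
    · have hproj : proj x y (σ ++ [w]) = proj x y σ := by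
        rw [proj_append, proj_cons_of_not hw]
        simp [proj]
      have h1 : q ≤ σ.count u := (hcases u q hq).resolve_right fun h => hw (h.1 ▸ hu)
      have h2 : r ≤ σ.count v := (hcases v r hr).resolve_right fun h => hw (h.1 ▸ hv)
      rw [hproj, requestTime_append_singleton h1, requestTime_append_singleton h2]
      exact ih q r h1 h2

/-- The key by which a critical request algorithm sorts the item `x` if all but the last `f` of its
requests are taken into account: smaller keys come first. -/
noncomputable def sortKey {n : ℕ} (L₀ : ListState n) (σ : List (Fin n)) (x : Fin n) (f : ℕ) : ℕᵒᵈ ×ₗ Fin n :=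
  toLex (OrderDual.toDual (requestTime σ x (σ.count x - f)), L₀ x)

theorem toLex_lt_iff {n : ℕ} {a b : ℕ} {u v : Fin n} :
    (toLex (OrderDual.toDual a, u) : ℕᵒᵈ ×ₗ Fin n) < toLex (OrderDual.toDual b, v) ↔
      b < a ∨ (a = b ∧ u < v) := by
  rw [Prod.Lex.toLex_lt_toLex]
  simp

theorem criticalRequestAlgorithm_lt_iff {n : ℕ} (F : Fin n → ℕ → ℕ) (L₀ : ListState n)
    (σ : List (Fin n)) (x y : Fin n) :
    criticalRequestAlgorithm F L₀ σ x < criticalRequestAlgorithm F L₀ σ y ↔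
      (toLex (OrderDual.toDual (requestTime σ x (F x (σ.count x))), L₀ x) : ℕᵒᵈ ×ₗ Fin n) <
        toLex (OrderDual.toDual (requestTime σ y (F y (σ.count y))), L₀ y) := by
  set f : Fin n → ℕᵒᵈ ×ₗ Fin n := fun x =>
    toLex (OrderDual.toDual (requestTime σ x (F x (σ.count x))), L₀ x) with hf
  have hinj : Function.Injective f := fun a b h =>
    L₀.injective (Prod.ext_iff.1 (toLex.injective h)).2
  have hmono : StrictMono (f ∘ Tuple.sort f) :=
    (Tuple.monotone_sort f).strictMono_of_injective (hinj.comp (Tuple.sort f).injective)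
  have := hmono.lt_iff_lt (a := (Tuple.sort f).symm x) (b := (Tuple.sort f).symm y)
  simp only [Function.comp, Equiv.apply_symm_apply] at this
  exact this.symm

theorem criticalRequestAlgorithm_lt_iff_sortKey {n : ℕ} {F f : Fin n → ℕ → ℕ}
    (hF : ∀ x i, F x i = i - f x i) (L₀ : ListState n) (σ : List (Fin n)) (x y : Fin n) :
    criticalRequestAlgorithm F L₀ σ x < criticalRequestAlgorithm F L₀ σ y ↔
      sortKey L₀ σ x (f x (σ.count x)) < sortKey L₀ σ y (f y (σ.count y)) := by
  rw [criticalRequestAlgorithm_lt_iff, hF, hF]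
  rfl

theorem criticalRequestAlgorithm_isProjective {n : ℕ} {F : Fin n → ℕ → ℕ} (hF : ∀ x i, F x i ≤ i)
    (L₀ : ListState n) : (criticalRequestAlgorithm F L₀).IsProjective := by
  intro x y σ
  have hcx : (proj x y σ).count x = σ.count x := count_proj_left x y σ
  have hcy : (proj x y σ).count y = σ.count y := by
    rw [proj, List.count_filter (by simp)]
  rw [criticalRequestAlgorithm_lt_iff, criticalRequestAlgorithm_lt_iff, toLex_lt_iff, toLex_lt_iff,
    hcx, hcy]
  have h1 := requestTime_lt_iff_proj (Or.inl rfl : x = x ∨ x = y) (Or.inr rfl : y = x ∨ y = y) σ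
    _ _ (hF x _) (hF y _)
  have h2 := requestTime_lt_iff_proj (Or.inr rfl : y = x ∨ y = y) (Or.inl rfl : x = x ∨ x = y) σ
    _ _ (hF y _) (hF x _)
  have h3 : ∀ a b a' b' : ℕ, (a < b ↔ a' < b') → (b < a ↔ b' < a') → (a = b ↔ a' = b') := by
    intro a b a' b'
    omega
  rw [h2, h3 _ _ _ _ h1 h2]

section Keys

variable {n : ℕ} (L₀ : ListState n) (σ : List (Fin n))

theorem sortKey_append_of_ne {x w : Fin n} (h : w ≠ x) (f : ℕ) :
    sortKey L₀ (σ ++ [w]) x f = sortKey L₀ σ x f := by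
  have hc : (σ ++ [w]).count x = σ.count x := by
    rw [List.count_append, List.count_singleton, if_neg (by simpa using h), add_zero]
  rw [sortKey, hc, requestTime_append_singleton (Nat.sub_le _ _), sortKey]

theorem sortKey_append_self_one (x : Fin n) : sortKey L₀ (σ ++ [x]) x 1 = sortKey L₀ σ x 0 := by
  have hc : (σ ++ [x]).count x = σ.count x + 1 := by simp
  rw [sortKey, hc, Nat.add_sub_cancel, requestTime_append_singleton le_rfl, sortKey, Nat.sub_zero]

theorem sortKey_append_self_zero_lt (x y : Fin n) (f : ℕ) :
    sortKey L₀ (σ ++ [x]) x 0 < sortKey L₀ σ y f := by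
  have hc : (σ ++ [x]).count x = σ.count x + 1 := by simp
  rw [sortKey, hc, Nat.sub_zero, requestTime_append_self, sortKey, toLex_lt_iff]
  left
  have := requestTime_le_length (σ := σ) (x := y) (q := σ.count y - f) (Nat.sub_le _ _)
  omega

theorem sortKey_zero_le_one (x : Fin n) : sortKey L₀ σ x 0 ≤ sortKey L₀ σ x 1 := by
  induction σ using List.reverseRecOn with
  | nil => exact le_rfl
  | append_singleton σ w ih =>
    by_cases h : w = x
    · subst h
      rw [sortKey_append_self_one]
      exact (sortKey_append_self_zero_lt L₀ σ w w 0).le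
    · rw [sortKey_append_of_ne L₀ σ h, sortKey_append_of_ne L₀ σ h]
      exact ih

/-- If the critical request is always the last one or the last but one, then a requested item
moves, if at all, only towards the front, and no other two items change their order. -/
theorem cost_criticalRequestAlgorithm_le {F f : Fin n → ℕ → ℕ} (hF : ∀ x i, F x i = i - f x i)
    (hf : ∀ x i, f x i < 2) :
    (criticalRequestAlgorithm F L₀).cost σ ≤
      sumAlong (fun V w => (criticalRequestAlgorithm F L₀ V w : ℕ)) [] σ := by
  rw [← sum_fin_eq_sumAlong, OnlineAlgorithm.cost, serveCost]
  refine Finset.sum_le_sum fun k _ => ?_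
  set w := σ.get k with hw
  have htake : σ.take (k + 1) = σ.take k ++ [w] := by
    rw [hw, List.get_eq_getElem, List.take_append_getElem]
  simp only [List.nil_append, htake]
  set V := σ.take k with hV
  apply rearrangeCost_add_accessCost_le_position
  · intro u v hu hv h
    rw [criticalRequestAlgorithm_lt_iff_sortKey hF] at h ⊢
    rw [sortKey_append_of_ne L₀ V hu.symm, sortKey_append_of_ne L₀ V hv.symm]
    rwa [List.count_append, List.count_append, List.count_singleton, List.count_singleton,
      if_neg (by simpa using hu.symm), if_neg (by simpa using hv.symm), add_zero, add_zero]
  · intro u h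
    have hu : w ≠ u := by
      rintro rfl
      exact lt_irrefl _ h
    rw [criticalRequestAlgorithm_lt_iff_sortKey hF] at h ⊢
    rw [sortKey_append_of_ne L₀ V hu]
    have hcu : (V ++ [w]).count u = V.count u := by
      rw [List.count_append, List.count_singleton, if_neg (by simpa using hu), add_zero]
    rw [hcu]
    rcases (by have := hf w ((V ++ [w]).count w); omega :
      f w ((V ++ [w]).count w) = 0 ∨ f w ((V ++ [w]).count w) = 1) with h0 | h1
    · rw [h0]
      exact sortKey_append_self_zero_lt L₀ V w u _
    · rw [h1, sortKey_append_self_one]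
      refine lt_of_le_of_lt ?_ h
      rcases (by have := hf w (V.count w); omega : f w (V.count w) = 0 ∨ f w (V.count w) = 1)
        with h2 | h2 <;> rw [h2]
      exact sortKey_zero_le_one L₀ V w

end Keys

/-! ### The pairwise analysis of COMB -/

/-- The possible orders of the last two requests to `x` and the last two requests to `y`, as far as
they matter: the name lists the relevant end of the sequence of requests to `x` and `y`. -/
inductive PairState
  | xx | xy | xyx | yy | yx | yxy

namespace PairState

/-- The transition at a request to `x` (`true`) or to `y` (`false`). -/
def step : PairState → Bool → PairState
  | xx, true => xx
  | xx, false => xy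
  | xy, true => xyx
  | xy, false => yy
  | xyx, true => xx
  | xyx, false => yxy
  | yy, true => yx
  | yy, false => yy
  | yx, true => xx
  | yx, false => yxy
  | yxy, true => xyx
  | yxy, false => yy

/-- What a state says about the keys `a₀`, `a₁` of the last two requests to `x` and the keys `b₀`,
`b₁` of the last two requests to `y`. -/
def Holds {κ : Type*} [LinearOrder κ] (a₀ a₁ b₀ b₁ : κ) : PairState → Prop
  | xx => a₀ ≤ a₁ ∧ a₁ < b₀ ∧ b₀ ≤ b₁
  | xy => b₀ < a₀ ∧ a₀ ≤ a₁ ∧ a₁ < b₁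
  | xyx => a₀ < b₀ ∧ b₀ < a₁ ∧ a₁ < b₁
  | yy => b₀ ≤ b₁ ∧ b₁ < a₀ ∧ a₀ ≤ a₁
  | yx => a₀ < b₀ ∧ b₀ ≤ b₁ ∧ b₁ < a₁
  | yxy => b₀ < a₀ ∧ a₀ < b₁ ∧ b₁ < a₁

theorem Holds.step_true {κ : Type*} [LinearOrder κ] {a₀ a₁ b₀ b₁ c : κ} {q : PairState}
    (h : q.Holds a₀ a₁ b₀ b₁) (hc : c < a₀) (hc' : c < b₀) : (q.step true).Holds c a₀ b₀ b₁ := by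
  cases q <;> simp only [Holds, step] at h ⊢ <;> obtain ⟨h1, h2, h3⟩ := h <;>
    refine ⟨?_, ?_, ?_⟩ <;> order

theorem Holds.step_false {κ : Type*} [LinearOrder κ] {a₀ a₁ b₀ b₁ c : κ} {q : PairState}
    (h : q.Holds a₀ a₁ b₀ b₁) (hc : c < a₀) (hc' : c < b₀) : (q.step false).Holds a₀ a₁ c b₀ := by
  cases q <;> simp only [Holds, step] at h ⊢ <;> obtain ⟨h1, h2, h3⟩ := h <;>
    refine ⟨?_, ?_, ?_⟩ <;> order

/-- Five times the probability that COMB has the other item in front of the item which is requested: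
`x` (`true`) or `y` (`false`). -/
def cost : PairState → Bool → ℕ
  | xx, true => 0
  | xx, false => 5
  | xy, true => 2
  | xy, false => 3
  | xyx, true => 1
  | xyx, false => 4
  | yy, true => 5
  | yy, false => 0
  | yx, true => 3
  | yx, false => 2
  | yxy, true => 4
  | yxy, false => 1

/-- The potential of a state if the offline algorithm has `x` in front of `y` (`true`) or `y` in
front of `x` (`false`). -/
def potential : PairState → Bool → ℕ
  | xx, true => 0
  | xx, false => 8
  | xy, _ => 3
  | xyx, true => 1
  | xyx, false => 5
  | yy, true => 8
  | yy, false => 0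
  | yx, _ => 3
  | yxy, true => 5
  | yxy, false => 1

/-- The amortized cost of COMB at a request is at most `8 / 5` times the offline cost: the offline
algorithm pays for exchanging the items and for having the other item in front. -/
theorem cost_add_potential_le (q : PairState) (w o o' : Bool) :
    q.cost w + (q.step w).potential o' ≤
      q.potential o + 8 * ((if o = o' then 0 else 1) + (if w = o' then 0 else 1)) := by
  cases q <;> cases w <;> cases o <;> cases o' <;> decide

theorem potential_le_add (q : PairState) (o o' : Bool) :
    q.potential o' ≤ q.potential o + 8 * (if o = o' then 0 else 1) := by
  cases q <;> cases o <;> cases o' <;> decide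

theorem potential_le (q : PairState) (o : Bool) : q.potential o ≤ 8 := by
  cases q <;> cases o <;> decide

end PairState

/-- Five times the probability that COMB has an item with the keys `b₀`, `b₁` of its last two
requests in front of an item with the keys `a₀`, `a₁`. BIT takes each of these keys with probability
`1 / 2`, TS takes `b₁` and `a₁`. -/
def behindWeight {κ : Type*} [LinearOrder κ] (a₀ a₁ b₀ b₁ : κ) : ℕ :=
  (if b₀ < a₀ then 1 else 0) + (if b₀ < a₁ then 1 else 0) + (if b₁ < a₀ then 1 else 0) +
    (if b₁ < a₁ then 1 else 0) + (if b₁ < a₁ then 1 else 0)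

theorem PairState.Holds.behindWeight_le_true {κ : Type*} [LinearOrder κ] {a₀ a₁ b₀ b₁ : κ}
    {q : PairState} (h : q.Holds a₀ a₁ b₀ b₁) : behindWeight a₀ a₁ b₀ b₁ ≤ q.cost true := by
  unfold behindWeight
  cases q <;> simp only [Holds, cost] at h ⊢ <;> obtain ⟨h1, h2, h3⟩ := h
  · rw [if_neg (by order), if_neg (by order), if_neg (by order), if_neg (by order)]
  · rw [if_pos (by order), if_pos (by order), if_neg (by order), if_neg (by order)]
  · rw [if_neg (by order), if_pos (by order), if_neg (by order), if_neg (by order)]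
  · split_ifs <;> omega
  · rw [if_neg (by order : ¬ b₀ < a₀), if_neg (by order : ¬ b₁ < a₀)]
    split_ifs <;> omega
  · rw [if_neg (by order : ¬ b₁ < a₀)]
    split_ifs <;> omega

theorem PairState.Holds.behindWeight_le_false {κ : Type*} [LinearOrder κ] {a₀ a₁ b₀ b₁ : κ}
    {q : PairState} (h : q.Holds a₀ a₁ b₀ b₁) : behindWeight b₀ b₁ a₀ a₁ ≤ q.cost false := by
  unfold behindWeight
  cases q <;> simp only [Holds, cost] at h ⊢ <;> obtain ⟨h1, h2, h3⟩ := h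
  · split_ifs <;> omega
  · rw [if_neg (by order : ¬ a₀ < b₀), if_neg (by order : ¬ a₁ < b₀)]
    split_ifs <;> omega
  · rw [if_neg (by order : ¬ a₁ < b₀)]
    split_ifs <;> omega
  · rw [if_neg (by order), if_neg (by order), if_neg (by order), if_neg (by order)]
  · rw [if_pos (by order), if_pos (by order), if_neg (by order), if_neg (by order)]
  · rw [if_neg (by order), if_pos (by order), if_neg (by order), if_neg (by order)]

section Pairs

variable {n : ℕ} (L₀ : ListState n)

/-- The state of the pair `x`, `y` after a request sequence. At the start, it is as if the item in
front had just been requested twice. -/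
def pairState (σ : List (Fin n)) (x y : Fin n) : PairState :=
  σ.foldl (fun q w => if w = x then q.step true else if w = y then q.step false else q)
    (if L₀ x < L₀ y then .xx else .yy)

theorem pairState_append_singleton (σ : List (Fin n)) (x y w : Fin n) :
    pairState L₀ (σ ++ [w]) x y = if w = x then (pairState L₀ σ x y).step true
      else if w = y then (pairState L₀ σ x y).step false else pairState L₀ σ x y := by
  simp [pairState]

theorem pairState_holds (σ : List (Fin n)) {x y : Fin n} (hxy : x ≠ y) :
    (pairState L₀ σ x y).Holds (sortKey L₀ σ x 0) (sortKey L₀ σ x 1) (sortKey L₀ σ y 0)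
      (sortKey L₀ σ y 1) := by
  induction σ using List.reverseRecOn with
  | nil =>
    have hlt : ∀ {u v : Fin n} (f g : ℕ), L₀ u < L₀ v → sortKey L₀ [] u f < sortKey L₀ [] v g := by
      intro u v f g h
      rw [sortKey, sortKey, toLex_lt_iff]
      right
      simp [requestTime_zero, h]
    have hle : ∀ u : Fin n, sortKey L₀ [] u 0 ≤ sortKey L₀ [] u 1 := fun u => le_rfl
    by_cases h : L₀ x < L₀ y
    · rw [show pairState L₀ [] x y = .xx by simp [pairState, h]]
      exact ⟨hle x, hlt _ _ h, hle y⟩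
    · rw [show pairState L₀ [] x y = .yy by simp [pairState, h]]
      have h' : L₀ y < L₀ x := lt_of_le_of_ne (not_lt.1 h) fun he => hxy (L₀.injective he).symm
      exact ⟨hle y, hlt _ _ h', hle x⟩
  | append_singleton σ w ih =>
    rw [pairState_append_singleton]
    by_cases hx : w = x
    · subst hx
      rw [if_pos rfl, sortKey_append_self_one, sortKey_append_of_ne L₀ σ hxy,
        sortKey_append_of_ne L₀ σ hxy]
      exact ih.step_true (sortKey_append_self_zero_lt L₀ σ w w 0)
        (sortKey_append_self_zero_lt L₀ σ w y 0)
    · rw [if_neg hx, sortKey_append_of_ne L₀ σ hx, sortKey_append_of_ne L₀ σ hx]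
      by_cases hy : w = y
      · subst hy
        rw [if_pos rfl, sortKey_append_self_one]
        exact ih.step_false (sortKey_append_self_zero_lt L₀ σ w x 0)
          (sortKey_append_self_zero_lt L₀ σ w w 0)
      · rw [if_neg hy, sortKey_append_of_ne L₀ σ hy, sortKey_append_of_ne L₀ σ hy]
        exact ih

/-- Five times the probability that COMB has the item `u` in front of the item `w`. -/
noncomputable def combWeight (σ : List (Fin n)) (w u : Fin n) : ℕ :=
  behindWeight (sortKey L₀ σ w 0) (sortKey L₀ σ w 1) (sortKey L₀ σ u 0) (sortKey L₀ σ u 1)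

/-- The amortized inequality for the pair `x`, `y` when the offline algorithm goes from `s` to `t` and
accesses `w`. -/
theorem pair_amortized_le (V : List (Fin n)) (s t : ListState n) (w : Fin n) {x y : Fin n}
    (hxy : x ≠ y) :
    (if w = x then combWeight L₀ V w y else 0) + (if w = y then combWeight L₀ V w x else 0) +
        (pairState L₀ (V ++ [w]) x y).potential (decide (t x < t y)) ≤
      (pairState L₀ V x y).potential (decide (s x < s y)) +
        8 * (((if (x, y) ∈ inversions s t then 1 else 0) +
            (if (y, x) ∈ inversions s t then 1 else 0)) +
          ((if w = x then (if t y < t w then 1 else 0) else 0) +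
            (if w = y then (if t x < t w then 1 else 0) else 0))) := by
  have hH := pairState_holds L₀ V hxy
  have hinv : (if decide (s x < s y) = decide (t x < t y) then 0 else 1) =
      (if (x, y) ∈ inversions s t then 1 else 0) + (if (y, x) ∈ inversions s t then 1 else 0) := by
    have hs : s y < s x ↔ ¬ s x < s y := by
      rw [not_lt, le_iff_lt_or_eq]
      exact ⟨Or.inl, fun h => h.resolve_right fun he => hxy (s.injective he).symm⟩
    have ht : t y < t x ↔ ¬ t x < t y := by
      rw [not_lt, le_iff_lt_or_eq]
      exact ⟨Or.inl, fun h => h.resolve_right fun he => hxy (t.injective he).symm⟩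
    by_cases h1 : s x < s y <;> by_cases h2 : t x < t y <;> simp [mem_inversions, hs, ht, h1, h2]
  rw [pairState_append_singleton, ← hinv]
  by_cases hx : w = x
  · subst hx
    have h1 := hH.behindWeight_le_true
    have h2 := (pairState L₀ V w y).cost_add_potential_le true (decide (s w < s y))
      (decide (t w < t y))
    have h3 : (if true = decide (t w < t y) then 0 else 1) ≤ if t y < t w then 1 else 0 := by
      rcases lt_trichotomy (t w) (t y) with h | h | h
      · simp [h]
      · exact absurd (t.injective h) hxy
      · simp [h, h.not_gt]
    rw [if_pos rfl, if_pos rfl, if_pos rfl, if_neg hxy, if_neg hxy, combWeight]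
    omega
  · by_cases hy : w = y
    · subst hy
      have h1 := hH.behindWeight_le_false
      have h2 := (pairState L₀ V x w).cost_add_potential_le false (decide (s x < s w))
        (decide (t x < t w))
      have h3 : (if false = decide (t x < t w) then 0 else 1) ≤ if t x < t w then 1 else 0 := by
        by_cases h : t x < t w <;> simp [h]
      rw [if_neg hx, if_neg hx, if_neg hx, if_pos rfl, if_pos rfl, if_pos rfl, combWeight]
      omega
    · have h2 := (pairState L₀ V x y).potential_le_add (decide (s x < s y)) (decide (t x < t y))
      rw [if_neg hx, if_neg hx, if_neg hx, if_neg hy, if_neg hy, if_neg hy]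
      omega

/-- The sum of the potentials of all pairs (each pair is counted in both orders). -/
def totalPotential (V : List (Fin n)) (s : ListState n) : ℕ :=
  ∑ x, ∑ y ∈ Finset.univ.erase x, (pairState L₀ V x y).potential (decide (s x < s y))

theorem sum_erase_ite_left (w : Fin n) (g : Fin n → ℕ) :
    ∑ x, ∑ y ∈ Finset.univ.erase x, (if w = x then g y else 0) = ∑ u ∈ Finset.univ.erase w, g u := by
  rw [Finset.sum_eq_single w]
  · simp
  · intro x _ hx
    simp [hx.symm]
  · simp

theorem sum_erase_comm (f : Fin n → Fin n → ℕ) :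
    ∑ x, ∑ y ∈ Finset.univ.erase x, f x y = ∑ x, ∑ y ∈ Finset.univ.erase x, f y x := by
  apply Finset.sum_comm'
  intro x y
  simp [eq_comm]

theorem sum_erase_inversions_le (s t : ListState n) :
    ∑ x, ∑ y ∈ Finset.univ.erase x, (if (x, y) ∈ inversions s t then 1 else 0) ≤
      rearrangeCost s t := by
  rw [rearrangeCost_eq_card_inversions]
  calc _ ≤ ∑ x, ∑ y, (if (x, y) ∈ inversions s t then 1 else 0) :=
        Finset.sum_le_sum fun x _ => Finset.sum_le_sum_of_subset (Finset.erase_subset _ _)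
    _ = ∑ p : Fin n × Fin n, (if p ∈ inversions s t then 1 else 0) := by
        rw [Fintype.sum_prod_type]
    _ = (inversions s t).card := by simp

theorem sum_erase_inFront (t : ListState n) (w : Fin n) :
    ∑ u ∈ Finset.univ.erase w, (if t u < t w then 1 else 0) = (t w : ℕ) := by
  rw [← card_inFront t w, Finset.card_filter, ← Finset.add_sum_erase _ _ (Finset.mem_univ w)]
  simp

theorem amortized_le (V : List (Fin n)) (s t : ListState n) (w : Fin n) :
    2 * ∑ u ∈ Finset.univ.erase w, combWeight L₀ V w u + totalPotential L₀ (V ++ [w]) t ≤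
      totalPotential L₀ V s + 16 * (rearrangeCost s t + accessCost t w) := by
  have h := Finset.sum_le_sum fun x (_ : x ∈ Finset.univ) => Finset.sum_le_sum
    fun y (hy : y ∈ Finset.univ.erase x) =>
      pair_amortized_le L₀ V s t w (Finset.ne_of_mem_erase hy).symm
  simp only [Finset.sum_add_distrib, ← Finset.mul_sum] at h
  have e1 := sum_erase_ite_left w (fun u => combWeight L₀ V w u)
  have e2 := (sum_erase_comm fun x y => if w = y then combWeight L₀ V w x else 0).trans e1
  have e3 := sum_erase_inversions_le s t
  have e4 := (sum_erase_comm fun x y => if (y, x) ∈ inversions s t then 1 else 0).trans_le e3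
  have e5 := (sum_erase_ite_left w fun u => if t u < t w then 1 else 0).trans
    (sum_erase_inFront t w)
  have e6 := (sum_erase_comm fun x y => if w = y then (if t x < t w then 1 else 0) else 0).trans e5
  rw [e1, e2, e5, e6] at h
  simp only [totalPotential, accessCost]
  omega

theorem two_mul_sumAlong_combWeight_le (σ : List (Fin n)) :
    ∀ (V : List (Fin n)) (T : ℕ → ListState n),
      2 * sumAlong (fun V w => ∑ u ∈ Finset.univ.erase w, combWeight L₀ V w u) V σ ≤
        totalPotential L₀ V (T 0) + 16 * serveCost T σ := by
  induction σ with
  | nil => intro V T; simp [sumAlong]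
  | cons w σ ih =>
    intro V T
    rw [sumAlong, serveCost_cons]
    have h1 := ih (V ++ [w]) (fun k => T (k + 1))
    have h2 := amortized_le L₀ V (T 0) (T 1) w
    simp only [zero_add] at h1
    omega

theorem sumAlong_combWeight_le (σ : List (Fin n)) :
    sumAlong (fun V w => ∑ u ∈ Finset.univ.erase w, combWeight L₀ V w u) [] σ ≤
      8 * OPT L₀ σ + 4 * (n * n) := by
  obtain ⟨T, hT, hc⟩ := exists_serveCost_eq_OPT L₀ σ
  have h1 := two_mul_sumAlong_combWeight_le L₀ σ [] T
  have h2 : totalPotential L₀ [] (T 0) ≤ 8 * (n * n) := by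
    calc totalPotential L₀ [] (T 0) ≤ ∑ x : Fin n, ∑ y ∈ Finset.univ.erase x, 8 :=
          Finset.sum_le_sum fun x _ => Finset.sum_le_sum fun y _ => PairState.potential_le _ _
      _ ≤ ∑ x : Fin n, ∑ y : Fin n, 8 :=
          Finset.sum_le_sum fun x _ => Finset.sum_le_sum_of_subset (Finset.erase_subset _ _)
      _ = 8 * (n * n) := by
          simp
          ring
  omega

end Pairs

/-! ### The expected cost of COMB -/

/-- After any numbers of requests, the positions of the critical requests of BIT to two items are
uniformly distributed on the four possibilities. -/
theorem four_mul_sum_bits {n : ℕ} {x y : Fin n} (hxy : x ≠ y) (i j : ℕ) (g : ℕ → ℕ → ℕ) :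
    4 * ∑ b : Fin n → Fin 2, g (((b x : ℕ) + i) % 2) (((b y : ℕ) + j) % 2) =
      2 ^ n * (g 0 0 + g 0 1 + g 1 0 + g 1 1) := by
  set G : (Fin n → Fin 2) → ℕ := fun b => g (((b x : ℕ) + i) % 2) (((b y : ℕ) + j) % 2) with hG
  have hshift : ∀ c : Fin n → Fin 2, ∑ b, G (b + c) = ∑ b, G b := fun c =>
    Equiv.sum_comp (Equiv.addRight c) G
  calc 4 * ∑ b, G b = ∑ b, (G b + G (b + Pi.single x 1) + G (b + Pi.single y 1) +
        G (b + (Pi.single x 1 + Pi.single y 1))) := by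
        simp only [Finset.sum_add_distrib, hshift]
        ring
    _ = ∑ b : Fin n → Fin 2, (g 0 0 + g 0 1 + g 1 0 + g 1 1) := by
        refine Finset.sum_congr rfl fun b _ => ?_
        simp only [hG, Pi.add_apply, Pi.single_eq_same, Pi.single_eq_of_ne hxy,
          Pi.single_eq_of_ne hxy.symm, add_zero, zero_add]
        generalize b x = p
        generalize b y = q
        rcases Nat.mod_two_eq_zero_or_one i with hi | hi <;>
          rcases Nat.mod_two_eq_zero_or_one j with hj | hj <;>
          fin_cases p <;> fin_cases q <;>
          simp [Nat.add_mod, hi, hj] <;> ring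
    _ = 2 ^ n * (g 0 0 + g 0 1 + g 1 0 + g 1 1) := by simp

theorem sum_sumAlong_eq {ι β : Type*} (s : Finset β) (φ : β → List ι → ι → ℕ)
    (φ' ψ : List ι → ι → ℕ) (c d e : ℕ)
    (h : ∀ V w, c * ∑ b ∈ s, φ b V w + d * φ' V w = e * ψ V w) (l : List ι) : ∀ V : List ι,
    c * ∑ b ∈ s, sumAlong (φ b) V l + d * sumAlong φ' V l = e * sumAlong ψ V l := by
  induction l with
  | nil => intro V; simp [sumAlong]
  | cons w l ih =>
    intro V
    simp only [sumAlong, Finset.sum_add_distrib, mul_add]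
    rw [← h V w, ← ih (V ++ [w])]
    ring

theorem bitF_eq {n : ℕ} (b : Fin n → Fin 2) (x : Fin n) (i : ℕ) :
    bitF b x i = i - ((b x : ℕ) + i) % 2 := rfl

theorem tsF_eq {n : ℕ} (x : Fin n) (i : ℕ) : tsF x i = i - 1 := rfl

/-- `5 · 2 ^ n` times the expected position of `w` under COMB. -/
theorem four_mul_sum_position {n : ℕ} (L₀ : ListState n) (V : List (Fin n)) (w : Fin n) :
    4 * ∑ b : Fin n → Fin 2, (criticalRequestAlgorithm (bitF b) L₀ V w : ℕ) +
      2 ^ n * (criticalRequestAlgorithm tsF L₀ V w : ℕ) =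
      2 ^ n * ∑ u ∈ Finset.univ.erase w, combWeight L₀ V w u := by
  have hbit : ∀ u ∈ Finset.univ.erase w, 4 * ∑ b : Fin n → Fin 2,
      (if criticalRequestAlgorithm (bitF b) L₀ V u < criticalRequestAlgorithm (bitF b) L₀ V w
        then 1 else 0) + 2 ^ n * (if criticalRequestAlgorithm tsF L₀ V u <
          criticalRequestAlgorithm tsF L₀ V w then 1 else 0) = 2 ^ n * combWeight L₀ V w u := by
    intro u hu
    have hts : criticalRequestAlgorithm tsF L₀ V u < criticalRequestAlgorithm tsF L₀ V w ↔
        sortKey L₀ V u 1 < sortKey L₀ V w 1 :=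
      criticalRequestAlgorithm_lt_iff_sortKey tsF_eq L₀ V u w
    have hb : ∀ b : Fin n → Fin 2, criticalRequestAlgorithm (bitF b) L₀ V u <
        criticalRequestAlgorithm (bitF b) L₀ V w ↔
        sortKey L₀ V u (((b u : ℕ) + V.count u) % 2) <
          sortKey L₀ V w (((b w : ℕ) + V.count w) % 2) :=
      fun b => criticalRequestAlgorithm_lt_iff_sortKey (bitF_eq b) L₀ V u w
    simp only [hts, hb]
    rw [four_mul_sum_bits (Finset.ne_of_mem_erase hu) (V.count u) (V.count w)
      (fun f g => if sortKey L₀ V u f < sortKey L₀ V w g then 1 else 0), ← mul_add]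
    rfl
  rw [Finset.mul_sum (Finset.univ.erase w), ← Finset.sum_congr rfl hbit, Finset.sum_add_distrib, ← Finset.mul_sum,
    ← Finset.mul_sum, Finset.sum_comm, sum_erase_inFront]
  simp only [sum_erase_inFront]

instance instMeasurableSingletonClassListState (n : ℕ) : MeasurableSingletonClass (ListState n) :=
  ⟨fun _ => MeasurableSpace.measurableSet_top⟩

theorem COMB_isProjective {n : ℕ} (L₀ : ListState n) : (COMB L₀).IsProjective := by
  have hb : ∀ b : Fin n → Fin 2, (criticalRequestAlgorithm (bitF b) L₀).IsProjective := fun b =>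
    criticalRequestAlgorithm_isProjective (fun _ _ => Nat.sub_le _ _) L₀
  have ht : (criticalRequestAlgorithm (tsF (n := n)) L₀).IsProjective :=
    criticalRequestAlgorithm_isProjective (fun _ _ => Nat.sub_le _ _) L₀
  change ∀ᵐ S ∂combLaw L₀, OnlineAlgorithm.IsProjective S
  rw [ae_iff]
  simp [combLaw, bitLaw, Measure.dirac_apply, hb, ht]

theorem expectedCost_COMB {n : ℕ} (L₀ : ListState n) (σ : List (Fin n)) :
    (COMB L₀).expectedCost σ = 4 / 5 * ((2 ^ n)⁻¹ *
      ∑ b : Fin n → Fin 2, ((criticalRequestAlgorithm (bitF b) L₀).cost σ : ℝ)) +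
      1 / 5 * ((criticalRequestAlgorithm tsF L₀).cost σ : ℝ) := by
  have : IsFiniteMeasure (bitLaw L₀) := ⟨by rw [bitLaw_univ]; exact ENNReal.one_lt_top⟩
  have h1 : ∫ S, (OnlineAlgorithm.cost S σ : ℝ) ∂bitLaw L₀ = (2 ^ n)⁻¹ *
      ∑ b : Fin n → Fin 2, ((criticalRequestAlgorithm (bitF b) L₀).cost σ : ℝ) := by
    rw [bitLaw, integral_finsetSum_measure fun b _ =>
      (integrable_cost (Measure.dirac (criticalRequestAlgorithm (bitF b) L₀)) σ).smul_measure
        (by simp), Finset.mul_sum]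
    refine Finset.sum_congr rfl fun b _ => ?_
    rw [integral_smul_measure, integral_dirac]
    simp
  change ∫ S, (OnlineAlgorithm.cost S σ : ℝ) ∂combLaw L₀ = _
  rw [combLaw, integral_add_measure
    ((integrable_cost (bitLaw L₀) σ).smul_measure (ENNReal.div_ne_top (by simp) (by simp)))
    ((integrable_cost _ σ).smul_measure (ENNReal.div_ne_top (by simp) (by simp))),
    integral_smul_measure, integral_smul_measure, h1, integral_dirac]
  simp [ENNReal.toReal_div]

theorem COMB_isCompetitiveWith {n : ℕ} (L₀ : ListState n) :
    (COMB L₀).IsCompetitiveWith (8 / 5) (n * n) := by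
  intro σ
  rw [expectedCost_COMB]
  have h1 : ∀ b : Fin n → Fin 2, (criticalRequestAlgorithm (bitF b) L₀).cost σ ≤
      sumAlong (fun V w => (criticalRequestAlgorithm (bitF b) L₀ V w : ℕ)) [] σ := fun b =>
    cost_criticalRequestAlgorithm_le L₀ σ (bitF_eq b) fun _ _ => Nat.mod_lt _ (by norm_num)
  have h2 : (criticalRequestAlgorithm tsF L₀).cost σ ≤
      sumAlong (fun V w => (criticalRequestAlgorithm tsF L₀ V w : ℕ)) [] σ :=
    cost_criticalRequestAlgorithm_le L₀ σ tsF_eq fun _ _ => by norm_num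
  have h3 := sum_sumAlong_eq Finset.univ
    (fun (b : Fin n → Fin 2) V w => (criticalRequestAlgorithm (bitF b) L₀ V w : ℕ))
    (fun V w => (criticalRequestAlgorithm tsF L₀ V w : ℕ))
    (fun V w => ∑ u ∈ Finset.univ.erase w, combWeight L₀ V w u) 4 (2 ^ n) (2 ^ n)
    (four_mul_sum_position L₀) σ []
  have h4 : 4 * ∑ b : Fin n → Fin 2, (criticalRequestAlgorithm (bitF b) L₀).cost σ +
      2 ^ n * (criticalRequestAlgorithm tsF L₀).cost σ ≤ 2 ^ n * (8 * OPT L₀ σ + 4 * (n * n)) := by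
    refine le_trans (Nat.add_le_add (Nat.mul_le_mul_left _ (Finset.sum_le_sum fun b _ => h1 b))
      (Nat.mul_le_mul_left _ h2)) (h3.le.trans (Nat.mul_le_mul_left _ (sumAlong_combWeight_le L₀ σ)))
  have h5 : 4 * ∑ b : Fin n → Fin 2, ((criticalRequestAlgorithm (bitF b) L₀).cost σ : ℝ) +
      2 ^ n * ((criticalRequestAlgorithm tsF L₀).cost σ : ℝ) ≤
      2 ^ n * (8 * (OPT L₀ σ : ℝ) + 4 * (n * n)) := by
    exact_mod_cast h4
  have hpos : (0 : ℝ) < 2 ^ n := by positivity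
  have h6 := mul_le_mul_of_nonneg_left h5 (inv_nonneg.2 hpos.le)
  rw [mul_add, inv_mul_cancel_left₀ hpos.ne', inv_mul_cancel_left₀ hpos.ne'] at h6
  have h7 : (0 : ℝ) ≤ (n : ℝ) * n := by positivity
  linarith

end ListUpdate

theorem theorem6p1 (n : ℕ) (hn : 3 ≤ n) :
    (∀ (L₀ : ListUpdate.ListState n) (A : ListUpdate.RandomizedAlgorithm L₀), A.IsProjective →
      ∀ c b : ℝ, A.IsCompetitiveWith c b → 8 / 5 ≤ c) ∧
    (∀ L₀ : ListUpdate.ListState n, (ListUpdate.COMB L₀).IsProjective) ∧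
    (∃ b : ℝ, ∀ L₀ : ListUpdate.ListState n, (ListUpdate.COMB L₀).IsCompetitiveWith (8 / 5) b) :=
  ⟨fun _ _ hA _ _ hc => ListUpdate.eight_fifths_le_of_isCompetitiveWith hn hA hc,
    ListUpdate.COMB_isProjective, _, ListUpdate.COMB_isCompetitiveWith⟩
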